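/- Let $(\Omega,\mathcal F)$ be a measurable space. Write $C_{l,Lip}(\mathbb R^n)$ for the functions $\varphi:\mathbb R^n\to\mathbb R$ with $|\varphi(x)-\varphi(y)|\le C(1+|x|^m+|y|^m)|x-y|$ for all $x,y$ and some $C>0$, $m\in\mathbb N$. Let $\mathcal H$ be a class of real random variables on $\Omega$ such that $\varphi(X_1,\dots,X_n)\in\mathcal H$ whenever $X_1,\dots,X_n\in\mathcal H$ and $\varphi\in C_{l,Lip}(\mathbb R^n)$. Let $\mathbb E:\mathcal H\to[-\infty,\infty]$ be a sub-linear expectation: it is monotone, $\mathbb E[c]=c$ for real constants $c$, $\mathbb E[\lambda X]=\lambda\,\mathbb E[X]$ for $\lambda\ge 0$, and $\mathbb E[X+Y]\le\mathbb E[X]+\mathbb E[Y]$ whenever the right side is not of the form $\infty-\infty$ or $-\infty+\infty$. Assume that $\mathbb E$ is regular ($X_n\in\mathcal H$, $X_n\downarrow 0$ pointwise implies $\mathbb E[X_n]\to 0$) and countably sub-additive ($\mathbb E[X]\le\sum_n\mathbb E[X_n]$ whenever $X,X_n\in\mathcal H$ are nonnegative and $X\le\sum_n X_n$). Let $\mathcal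 P$ be any set of probability measures on $(\Omega,\mathcal F)$ that represents $\mathbb E$, i.e. $\mathbb E[X]=\sup_{P\in\mathcal P}E_P[X]$ for all $X\in\mathcal H$. Put $\mathbb V(A)=\sup_{P\in\mathcal P}P(A)$ for $A\in\mathcal F$, and, for a random variable $Y$, $$C_{\mathbb V}(Y)=\int_0^\infty \mathbb V(Y>x)\,dx+\int_{-\infty}^0\bigl(\mathbb V(Y>x)-1\bigr)\,dx .$$ A random vector $\mathbf Y$ with components in $\mathcal H$ is independent of a random vector $\mathbf X$ with components in $\mathcal H$ if $\mathbb E[\psi(\mathbf X,\mathbf Y)]=\mathbb E\bigl[\mathbb E[\psi(\mathbf x,\mathbf Y)]|_{\mathbf x=\mathbf X}\bigr]$ for all $\psi\in C_{l,Lip}$; a family of random variables is independent if its index set admits a total order such that each member is independent of every finite vector of members with strictly smaller indices. Two variables $X,Y\in\mathcal H$ are identically distributed if $\mathbb E[\psi(X)]=\mathbb E[\psi(Y)]$ for all $\psi\in C_{l,Lip}(\mathbb R)$. Write $\log^+x=\max(\log x,0)$ for $x>0$ and $\log^+0=0$. **Theorem.** Let $d\ge 2$ and $\alpha>1$, let $\mathbf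 Z_+^d$ be the set of $d$-tuples of positive integers with the coordinatewise order, and put $|\mathbf n|=n_1\cdots n_d$ for $\mathbf n\in\mathbf Z_+^d$. Let $X\in\mathcal H$ with $\mathbb E[X]=\mathbb E[-X]=0$, let $\{X_{\mathbf k},\ \mathbf k\in\mathbf Z_+^d\}\subset\mathcal H$ be independent, each $X_{\mathbf k}$ identically distributed with $X$, and let $S_{\mathbf n}=\sum_{\mathbf k\le\mathbf n}X_{\mathbf k}$. If $$C_{\mathbb V}\Bigl\{\exp\bigl\{(\log^+|X|)^\alpha\bigr\}\,(\log^+|X|)^{d-1}\Bigr\}<\infty,$$ then $$\sum_{\mathbf n\in\mathbf Z_+^d}\exp\bigl\{(\log|\mathbf n|)^\alpha\bigr\}\,\frac{(\log|\mathbf n|)^{\alpha-1}}{|\mathbf n|^2}\,\mathbb V\bigl(|S_{\mathbf n}|>|\mathbf n|\varepsilon\bigr)<\infty\qquad\text{for all }\varepsilon>1 .$$ -/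

import Mathlib

open MeasureTheory Filter Topology Set
open scoped ENNReal

namespace SubLin

/-- The class `C_{l,Lip}` of locally Lipschitz functions of polynomial growth.  It is used for
`V = ℝⁿ` and `V = ℝᵐ × ℝⁿ`; it does not depend on the choice of the norm there. -/
def LocLip {V : Type*} [NormedAddCommGroup V] (φ : V → ℝ) : Prop :=
  ∃ C : ℝ, 0 < C ∧ ∃ m : ℕ, ∀ x y : V,
    |φ x - φ y| ≤ C * (1 + ‖x‖ ^ m + ‖y‖ ^ m) * ‖x - y‖

/-- A regular, countably sub-additive sub-linear expectation `E` on a class `H` of random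
variables on `Ω` that is stable under `C_{l,Lip}` functions.
Only the values of `E` on `H` are meaningful. -/
structure SubLinearExpectation (Ω : Type*) [MeasurableSpace Ω] where
  H : Set (Ω → ℝ)
  E : (Ω → ℝ) → EReal
  measurable_of_mem : ∀ X ∈ H, Measurable X
  comp_mem : ∀ (n : ℕ) (X : Fin n → Ω → ℝ), (∀ i, X i ∈ H) →
    ∀ φ : (Fin n → ℝ) → ℝ, LocLip φ → (fun ω => φ (fun i => X i ω)) ∈ H
  mono : ∀ X ∈ H, ∀ Y ∈ H, (∀ ω, Y ω ≤ X ω) → E Y ≤ E X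
  const : ∀ c : ℝ, E (fun _ => c) = (c : EReal)
  pos_hom : ∀ X ∈ H, ∀ c : ℝ, 0 ≤ c → E (fun ω => c * X ω) = (c : EReal) * E X
  sub_add : ∀ X ∈ H, ∀ Y ∈ H, ¬ (E X = ⊤ ∧ E Y = ⊥) → ¬ (E X = ⊥ ∧ E Y = ⊤) →
    E (fun ω => X ω + Y ω) ≤ E X + E Y
  regular : ∀ X : ℕ → Ω → ℝ, (∀ n, X n ∈ H) → (∀ ω, Antitone fun n => X n ω) →
    (∀ ω, Tendsto (fun n => X n ω) atTop (𝓝 0)) →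
    Tendsto (fun n => E (X n)) atTop (𝓝 0)
  countably_sub_add : ∀ (Y : Ω → ℝ) (X : ℕ → Ω → ℝ), Y ∈ H → (∀ n, X n ∈ H) →
    (∀ ω, 0 ≤ Y ω) → (∀ n ω, 0 ≤ X n ω) →
    (∀ ω, ENNReal.ofReal (Y ω) ≤ ∑' n, ENNReal.ofReal (X n ω)) →
    (E Y).toENNReal ≤ ∑' n, (E (X n)).toENNReal

variable {Ω : Type*} [MeasurableSpace Ω]

/-- The linear expectation `E_P[X] = E_P[X⁺] - E_P[X⁻]`, with values in `[-∞, ∞]`. -/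
noncomputable def linExp (P : ProbabilityMeasure Ω) (X : Ω → ℝ) : EReal :=
  ((∫⁻ ω, ENNReal.ofReal (X ω) ∂(P : Measure Ω) : ℝ≥0∞) : EReal)
    - ((∫⁻ ω, ENNReal.ofReal (-X ω) ∂(P : Measure Ω) : ℝ≥0∞) : EReal)

/-- `sup_{P ∈ 𝒬} E_P[X]`. -/
noncomputable def upperExp (𝒬 : Set (ProbabilityMeasure Ω)) (X : Ω → ℝ) : EReal :=
  ⨆ P ∈ 𝒬, linExp P X

/-- `𝒬` represents the sub-linear expectation: `E[X] = sup_{P ∈ 𝒬} E_P[X]` for all `X ∈ H`. -/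
def Represents (𝒬 : Set (ProbabilityMeasure Ω)) (𝓔 : SubLinearExpectation Ω) : Prop :=
  ∀ X ∈ 𝓔.H, 𝓔.E X = upperExp 𝒬 X

/-- The upper probability `𝕍(A) = sup_{P ∈ 𝒬} P(A)`. -/
noncomputable def capacity (𝒬 : Set (ProbabilityMeasure Ω)) (A : Set Ω) : ℝ≥0∞ :=
  ⨆ P ∈ 𝒬, (P : Measure Ω) A

/-- The Choquet integral
`C_V(Y) = ∫_0^∞ V(Y > x) dx + ∫_{-∞}^0 (V(Y > x) - 1) dx`, with values in `[-∞, ∞]`. -/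
noncomputable def choquet (V : Set Ω → ℝ≥0∞) (Y : Ω → ℝ) : EReal :=
  ((∫⁻ x in Ioi (0 : ℝ), V {ω | x < Y ω} : ℝ≥0∞) : EReal)
    - ((∫⁻ x in Iio (0 : ℝ), (1 - V {ω | x < Y ω}) : ℝ≥0∞) : EReal)

/-- The random vector `Y` is independent of the random vector `X`:
`E[ψ(X, Y)] = E[E[ψ(x, Y)]|_{x = X}]` for all `ψ ∈ C_{l,Lip}`.
(Regularity makes `E` finite on `H`, so that `toReal` loses nothing.) -/
def IndepOf (𝓔 : SubLinearExpectation Ω) {ι κ : Type*} [Fintype ι] [Fintype κ]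
    (Y : κ → Ω → ℝ) (X : ι → Ω → ℝ) : Prop :=
  ∀ ψ : (ι → ℝ) × (κ → ℝ) → ℝ, LocLip ψ →
    𝓔.E (fun ω => ψ (fun i => X i ω, fun j => Y j ω)) =
      𝓔.E (fun ω => (𝓔.E (fun ω' => ψ (fun i => X i ω, fun j => Y j ω'))).toReal)

/-- `X` and `Y` are identically distributed. -/
def IdentDist (𝓔 : SubLinearExpectation Ω) (X Y : Ω → ℝ) : Prop :=
  ∀ ψ : ℝ → ℝ, LocLip ψ → 𝓔.E (fun ω => ψ (X ω)) = 𝓔.E (fun ω => ψ (Y ω))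

/-- A family of random variables is independent if its index set can be totally ordered in such
a way that every member is independent of each finite vector of strictly earlier members.
(Independence under a sub-linear expectation is not symmetric, so an order is needed; for
an index set enumerated as a sequence this gives the independent sequences.) -/
def IndepFamily (𝓔 : SubLinearExpectation Ω) {ι : Type*} (X : ι → Ω → ℝ) : Prop :=
  ∃ o : LinearOrder ι, ∀ (k : ι) (J : Finset ι), (∀ j ∈ J, o.lt j k) →
    IndepOf 𝓔 (fun _ : Unit => X k) (fun j : J => X j)

/-- The size `|n| = n₁ ⋯ n_d` of a lattice point. -/
noncomputable def size {d : ℕ} (n : Fin d → ℕ+) : ℝ := ∏ i, ((n i : ℕ) : ℝ)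

/-- The partial sum `S_n = ∑_{k ≤ n} X_k` for the coordinatewise order. -/
noncomputable def partialSum {d : ℕ} (X : (Fin d → ℕ+) → Ω → ℝ) (n : Fin d → ℕ+) (ω : Ω) : ℝ :=
  ∑ k ∈ Finset.Icc 1 n, X k ω

end SubLin

namespace SubLin

/-! Write `N = |n|` and truncate from above at level `N`. If `|S_n| > N ε`, then either some `|X_k|
> N` with `k ≤ n`, or one of the sums of `min (± X_k) N` exceeds `N ε` (`capacity_partialSum_le`).

The first event has capacity at most `N 𝕍(|X| > N)`, which leaves a lattice series of tails of `X`
(`tsum_tail_lt_top`). In `tsum_size_le` the largest coordinate `k` is summed first. If `p` is the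
product of the others, each term is spread over `(p (k - 1), p k]`, where `exp ((log x) ^ α)` varies
by a bounded factor because `p` is at most a fixed power of `k`. Summing `1 / p` over the remaining
coordinates costs `(1 + log x) ^ (d - 1)`, the logarithmic factor in the moment hypothesis, and a
change of variables turns the integral into the Choquet integral.

For the truncated sums, choose `1 / ε < l < 1` and apply the exponential Chebyshev inequality with
`h = l (log N) ^ α / N`. The moment generating function of one truncated variable is at most `exp (c
/ N)` under every measure in `𝒬` (`eventually_lintegral_exp_tilt_le`). Independence gives the
product of `N` such factors (`expectation_prod`), hence a bound of order `exp (-ε l (log N) ^ α)`.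
Since `ε l > 1`, this absorbs the weight and leaves the summable `1 / N ^ 2`. -/

/-! ### Lattice sums and integrals with logarithmic weights. -/

theorem tsum_pi_prod {β : Type*} (f : β → ℝ≥0∞) (k : ℕ) :
    ∑' m : Fin k → β, ∏ j, f (m j) = (∑' b, f b) ^ k := by
  induction k with
  | zero => simp
  | succ k ih =>
    rw [← (Fin.consEquiv (fun _ => β)).tsum_eq, ENNReal.tsum_prod']
    simp [Fin.prod_univ_succ, ENNReal.tsum_mul_left, ENNReal.tsum_mul_right, ih, pow_succ',
      Fin.consEquiv]

theorem tsum_inv_le_one_add_log {x : ℝ} (hx : 1 ≤ x) :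
    ∑' m : ℕ+, (if ((m : ℕ) : ℝ) ≤ x then ENNReal.ofReal ((m : ℕ) : ℝ)⁻¹ else 0)
      ≤ ENNReal.ofReal (1 + Real.log x) := by
  rw [tsum_pnat_eq_tsum_succ
    (f := fun m : ℕ => if (m : ℝ) ≤ x then ENNReal.ofReal (m : ℝ)⁻¹ else 0)]
  rw [tsum_eq_sum (s := Finset.range ⌊x⌋₊)]
  · calc _ ≤ ∑ b ∈ Finset.range ⌊x⌋₊, ENNReal.ofReal ((b + 1 : ℕ) : ℝ)⁻¹ := by
          refine Finset.sum_le_sum fun b _ => ?_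
          split_ifs <;> simp
      _ = ENNReal.ofReal (∑ b ∈ Finset.range ⌊x⌋₊, ((b + 1 : ℕ) : ℝ)⁻¹) :=
          (ENNReal.ofReal_sum_of_nonneg fun _ _ => by positivity).symm
      _ ≤ _ := by
          refine ENNReal.ofReal_le_ofReal ?_
          have := harmonic_floor_le_one_add_log x hx
          simpa [harmonic] using this
  · intro b hb
    rw [if_neg]
    rw [Finset.mem_range, not_lt] at hb
    rw [not_le]
    exact (Nat.lt_floor_add_one x).trans_le (by push_cast; gcongr)

theorem one_le_size {d : ℕ} (n : Fin d → ℕ+) : 1 ≤ size n := by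
  unfold size
  calc (1 : ℝ) = ∏ _i : Fin d, (1 : ℝ) := by simp
    _ ≤ _ := Finset.prod_le_prod (fun _ _ => by simp) fun i _ => by
      exact_mod_cast (one_le : 1 ≤ n i)

theorem coord_le_size {d : ℕ} (n : Fin d → ℕ+) (i : Fin d) : ((n i : ℕ) : ℝ) ≤ size n := by
  unfold size
  rw [← Finset.mul_prod_erase _ _ (Finset.mem_univ i)]
  refine le_mul_of_one_le_right (by positivity) ?_
  calc (1 : ℝ) = ∏ _i ∈ Finset.univ.erase i, (1 : ℝ) := by simp
    _ ≤ _ := Finset.prod_le_prod (fun _ _ => by simp) fun i _ => by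
      exact_mod_cast (one_le : 1 ≤ n i)

theorem size_insertNth {d : ℕ} (i : Fin (d + 1)) (k : ℕ+) (m : Fin d → ℕ+) :
    size (i.insertNth k m : Fin (d + 1) → ℕ+) = size m * (k : ℕ) := by
  unfold size
  rw [Fin.prod_univ_succAbove _ i]
  simp [mul_comm]

/-- A constant is its own average over `s`; `p` is the reciprocal of the length of `s`. -/
theorem le_setLIntegral_of_forall_le {T p q : ℝ≥0∞} {F : ℝ → ℝ≥0∞} {s : Set ℝ}
    (hs : MeasurableSet s) (hvol : volume s = q) (hpq : p * q = 1) (h : ∀ x ∈ s, T ≤ F x) :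
    T ≤ ∫⁻ x in s, p * F x := by
  calc T = ∫⁻ _ in s, p * T := by
        rw [setLIntegral_const, hvol, mul_right_comm, hpq, one_mul]
    _ ≤ _ := setLIntegral_mono' hs fun x hx => by gcongr; exact h x hx

/-- A sum over the lattice is bounded by an integral with a logarithmic weight: sum over the
largest coordinate first. -/
theorem tsum_size_le {d : ℕ} {T F : ℝ → ℝ≥0∞} (hF : Measurable F) (hT1 : T 1 = 0)
    (hT : ∀ p k : ℝ, 1 ≤ p → 2 ≤ k → p ≤ k ^ d → ∀ x ∈ Ioc (p * (k - 1)) (p * k),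
      T (p * k) ≤ F x) :
    ∑' n : Fin (d + 1) → ℕ+, T (size n)
      ≤ (d + 1) * ∫⁻ x in Ioi (1 : ℝ), ENNReal.ofReal (1 + Real.log x) ^ d * F x := by
  classical
  set μ : Measure ℝ := volume.restrict (Ioi 1) with hμ
  -- The cutoff `b ≤ x` keeps the sum of reciprocals finite, of size at most `1 + log x` per
  -- coordinate.
  let A : ℝ → ℕ+ → ℝ≥0∞ := fun x b =>
    if ((b : ℕ) : ℝ) ≤ x then ENNReal.ofReal ((b : ℕ) : ℝ)⁻¹ else 0
  have hA : ∀ b, Measurable fun x => A x b := fun b =>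
    Measurable.ite measurableSet_Ici measurable_const measurable_const
  let G : (Fin d → ℕ+) → ℝ → ℝ≥0∞ := fun m x => (∏ j, A x (m j)) * F x
  have hG : ∀ m, Measurable (G m) := fun m =>
    (Finset.measurable_prod _ fun j _ => hA (m j)).mul hF
  let I : (Fin d → ℕ+) → ℕ+ → Set ℝ := fun m k =>
    Ioc (size m * ((k : ℕ) - 1)) (size m * (k : ℕ))
  have hI : ∀ m, Pairwise (Function.onFun Disjoint (I m)) := by
    intro m
    refine (pairwise_disjoint_on _).2 fun k l hkl => ?_
    rw [Set.disjoint_left]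
    rintro x ⟨_, h1⟩ ⟨h2, _⟩
    have h3 : ((k : ℕ) : ℝ) ≤ (l : ℕ) - 1 := by
      have : ((k : ℕ) : ℝ) + 1 ≤ (l : ℕ) := by exact_mod_cast hkl
      linarith
    have := mul_le_mul_of_nonneg_left h3 (zero_le_one.trans (one_le_size m))
    linarith
  have key : ∀ (i : Fin (d + 1)) (k : ℕ+) (m : Fin d → ℕ+),
      (if ∀ j, (i.insertNth k m : Fin (d + 1) → ℕ+) j ≤ k then
        T (size (i.insertNth k m : Fin (d + 1) → ℕ+)) else 0) ≤ ∫⁻ x in I m k, G m x ∂μ := by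
    intro i k m
    split_ifs with h
    swap
    · simp
    have hm : ∀ j, m j ≤ k := fun j => by simpa using h (i.succAbove j)
    rw [size_insertNth]
    -- If the largest coordinate is 1, the interval is `(0, 1]`, outside the domain of integration;
    -- the term vanishes by `T 1 = 0`.
    rcases eq_or_ne k 1 with rfl | hk
    · have : size m = 1 := by
        unfold size
        exact Finset.prod_eq_one fun j _ => by
          have := le_antisymm (hm j) one_le
          simp [this]
      simp [this, hT1]
    have hk2 : (2 : ℝ) ≤ (k : ℕ) := by
      have h1 : 1 < k := lt_of_le_of_ne one_le (Ne.symm hk)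
      have : 2 ≤ (k : ℕ) := h1
      exact_mod_cast this
    have hp := one_le_size m
    have hsub : I m k ⊆ Ioi 1 := by
      rintro x ⟨hx, _⟩
      have : size m * 1 ≤ size m * ((k : ℕ) - 1) := by gcongr; linarith
      exact lt_of_le_of_lt (by linarith) hx
    rw [hμ, Measure.restrict_restrict measurableSet_Ioc, inter_eq_left.2 hsub]
    -- Here `x` is at least `size m`, hence at least every `m j`, so no cutoff is active.
    have hGx : ∀ x ∈ I m k, G m x = ENNReal.ofReal (size m)⁻¹ * F x := by
      rintro x ⟨hx, _⟩
      have hpx : size m ≤ x := by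
        have : size m * 1 ≤ size m * ((k : ℕ) - 1) := by gcongr; linarith
        linarith
      have hA' : ∀ j, A x (m j) = ENNReal.ofReal (((m j : ℕ) : ℝ)⁻¹) := fun j =>
        if_pos ((coord_le_size m j).trans hpx)
      simp only [G, hA']
      rw [← ENNReal.ofReal_prod_of_nonneg fun _ _ => by positivity]
      simp [size, Finset.prod_inv_distrib]
    rw [setLIntegral_congr_fun measurableSet_Ioc hGx]
    refine le_setLIntegral_of_forall_le measurableSet_Ioc (q := ENNReal.ofReal (size m)) ?_ ?_ ?_
    · rw [Real.volume_Ioc]; congr 1; ring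
    · rw [← ENNReal.ofReal_mul (by positivity), inv_mul_cancel₀ (by positivity),
        ENNReal.ofReal_one]
    · refine hT _ _ hp hk2 ?_
      unfold size
      calc _ ≤ ∏ _j : Fin d, ((k : ℕ) : ℝ) :=
            Finset.prod_le_prod (fun _ _ => by positivity) fun j _ => by exact_mod_cast hm j
        _ = _ := by simp
  have fixed : ∀ i : Fin (d + 1),
      ∑' n : Fin (d + 1) → ℕ+, (if ∀ j, n j ≤ n i then T (size n) else 0)
        ≤ ∫⁻ x, ENNReal.ofReal (1 + Real.log x) ^ d * F x ∂μ := by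
    intro i
    rw [← (Fin.insertNthEquiv (fun _ => ℕ+) i).tsum_eq, ENNReal.tsum_prod', ENNReal.tsum_comm]
    calc _ ≤ ∑' (m : Fin d → ℕ+) (k : ℕ+), ∫⁻ x in I m k, G m x ∂μ := by
          refine ENNReal.tsum_le_tsum fun m => ENNReal.tsum_le_tsum fun k => ?_
          simpa [Fin.insertNthEquiv] using key i k m
      _ ≤ ∑' m : Fin d → ℕ+, ∫⁻ x, G m x ∂μ := by
          refine ENNReal.tsum_le_tsum fun m => ?_
          rw [← lintegral_iUnion (fun _ => measurableSet_Ioc) (hI m)]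
          exact setLIntegral_le_lintegral _ _
      _ = ∫⁻ x, ∑' m : Fin d → ℕ+, G m x ∂μ :=
          (lintegral_tsum fun m => (hG m).aemeasurable).symm
      _ ≤ _ := by
          refine setLIntegral_mono' measurableSet_Ioi fun x hx => ?_
          simp only [G]
          rw [ENNReal.tsum_mul_right, tsum_pi_prod]
          gcongr
          exact tsum_inv_le_one_add_log (le_of_lt hx)
  calc _ ≤ ∑' n : Fin (d + 1) → ℕ+, ∑ i, (if ∀ j, n j ≤ n i then T (size n) else 0) := by
        refine ENNReal.tsum_le_tsum fun n => ?_
        -- Points with several maximal coordinates are counted repeatedly, which is harmless for an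
        -- upper bound.
        obtain ⟨i, hi⟩ := Finite.exists_max n
        refine le_trans ?_ (Finset.single_le_sum (fun _ _ => zero_le) (Finset.mem_univ i))
        rw [if_pos hi]
    _ = ∑ i, ∑' n : Fin (d + 1) → ℕ+, (if ∀ j, n j ≤ n i then T (size n) else 0) :=
        Summable.tsum_finsetSum fun _ _ => ENNReal.summable
    _ ≤ ∑ _i : Fin (d + 1), ∫⁻ x, ENNReal.ofReal (1 + Real.log x) ^ d * F x ∂μ :=
        Finset.sum_le_sum fun i _ => fixed i
    _ = _ := by simp

theorem tsum_inv_size_sq_lt_top (d : ℕ) :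
    ∑' n : Fin d → ℕ+, ENNReal.ofReal ((size n ^ 2)⁻¹) < ⊤ := by
  have h : ∀ n : Fin d → ℕ+, ENNReal.ofReal ((size n ^ 2)⁻¹)
      = ∏ j, ENNReal.ofReal ((((n j : ℕ) : ℝ) ^ 2)⁻¹) := by
    intro n
    rw [← ENNReal.ofReal_prod_of_nonneg fun _ _ => by positivity]
    simp [size, Finset.prod_inv_distrib, Finset.prod_pow]
  simp_rw [h]
  rw [tsum_pi_prod (fun b : ℕ+ => ENNReal.ofReal ((((b : ℕ) : ℝ) ^ 2)⁻¹))]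
  refine ENNReal.pow_lt_top (lt_top_iff_ne_top.2 ?_)
  refine Summable.tsum_ofReal_ne_top ?_
  exact (Real.summable_nat_pow_inv.2 one_lt_two).comp_injective PNat.coe_injective

/-! ### The weight `exp ((log x) ^ α)` and the series of tails. -/

/-- Bernoulli's inequality for `(1 + s) ^ α` with `1 + s = a / b`, multiplied by `b ^ α`. -/
theorem rpow_sub_rpow_le {α a b : ℝ} (hα : 1 ≤ α) (ha : 0 ≤ a) (hab : a ≤ b) :
    b ^ α - a ^ α ≤ α * b ^ (α - 1) * (b - a) := by
  rcases (ha.trans hab).eq_or_lt with hb | hb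
  · have : a = b := le_antisymm hab (hb ▸ ha)
    simp [this]
  have h := one_add_mul_self_le_rpow_one_add (s := (a - b) / b)
    (by rw [le_div_iff₀ hb]; linarith) hα
  have h1 : 1 + (a - b) / b = a / b := by field_simp; ring
  rw [h1, Real.div_rpow ha hb.le, le_div_iff₀ (by positivity)] at h
  rw [Real.rpow_sub_one hb.ne']
  have h2 : (1 + α * ((a - b) / b)) * b ^ α = b ^ α - α * (b ^ α / b) * (b - a) := by
    field_simp; ring
  linarith

/-- The bound is linear in `k` so as to cancel the increment `2 / k` of the logarithm. -/
theorem log_rpow_le_mul {β k : ℝ} (hβ : 0 < β) (hk : 1 ≤ k) : Real.log k ^ β ≤ β ^ β * k := by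
  have h := Real.log_le_rpow_div (x := k) (by linarith) (inv_pos.2 hβ)
  calc Real.log k ^ β ≤ (k ^ β⁻¹ / β⁻¹) ^ β := by
        gcongr
        exact Real.log_nonneg hk
    _ = β ^ β * k := by
        rw [Real.div_rpow (by positivity) (by positivity), ← Real.rpow_mul (by linarith),
          inv_mul_cancel₀ hβ.ne', Real.rpow_one, Real.inv_rpow hβ.le, div_inv_eq_mul, mul_comm]

/-- The weight `exp ((log y) ^ α)` changes at most by a constant factor over `(p (k - 1), p k]`
as long as `p ≤ k ^ d`. -/
theorem exp_log_rpow_le {α : ℝ} (hα : 1 < α) (d : ℕ) {p k x : ℝ} (hp : 1 ≤ p) (hk : 2 ≤ k)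
    (hpk : p ≤ k ^ d) (hx : p * (k - 1) ≤ x) (hx' : x ≤ p * k) :
    Real.exp (Real.log (p * k) ^ α)
      ≤ Real.exp (2 * α * ((d + 1) ^ (α - 1) * (α - 1) ^ (α - 1)))
        * Real.exp (Real.log x ^ α) := by
  have hx1 : 1 ≤ x := by nlinarith
  have hx0 : 0 < x := by linarith
  have hlx := Real.log_nonneg hx1
  have hlk := Real.log_nonneg (by linarith : (1 : ℝ) ≤ k)
  have hle : Real.log x ≤ Real.log (p * k) := Real.log_le_log hx0 hx'
  have hly : Real.log (p * k) ≤ (d + 1) * Real.log k := by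
    rw [Real.log_mul (by positivity) (by positivity)]
    have := Real.log_le_log (by positivity) hpk
    rw [Real.log_pow] at this
    linarith
  -- Use `log t ≤ t - 1` and `p k / x ≤ k / (k - 1) ≤ 1 + 2 / k`, the last because `k ≥ 2`.
  have hdiff : Real.log (p * k) - Real.log x ≤ 2 / k := by
    rw [← Real.log_div (by positivity) (by positivity)]
    refine (Real.log_le_sub_one_of_pos (by positivity)).trans ?_
    rw [sub_le_iff_le_add, div_le_iff₀ hx0]
    have h1 : (2 / k + 1) * (p * (k - 1)) ≤ (2 / k + 1) * x := by gcongr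
    refine le_trans ?_ h1
    have h2 : (2 / k + 1) * (p * (k - 1)) = p * k + p * (k - 2) / k := by field_simp; ring
    rw [h2]
    have : 0 ≤ p * (k - 2) / k := by
      have : 0 ≤ k - 2 := by linarith
      positivity
    linarith
  have h := rpow_sub_rpow_le hα.le hlx hle
  rw [← Real.exp_add]
  refine Real.exp_le_exp.2 ?_
  have hα1 : 0 < α - 1 := by linarith
  have h3 : Real.log (p * k) ^ (α - 1) ≤ (d + 1) ^ (α - 1) * ((α - 1) ^ (α - 1) * k) := by
    calc _ ≤ ((d + 1) * Real.log k) ^ (α - 1) := by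
          gcongr
          linarith
      _ = (d + 1) ^ (α - 1) * Real.log k ^ (α - 1) := Real.mul_rpow (by positivity) hlk
      _ ≤ _ := by gcongr; exact log_rpow_le_mul hα1 (by linarith)
  have h4 : α * Real.log (p * k) ^ (α - 1) * (Real.log (p * k) - Real.log x)
      ≤ α * ((d + 1) ^ (α - 1) * ((α - 1) ^ (α - 1) * k)) * (2 / k) := by
    gcongr
  have h5 : α * ((d + 1) ^ (α - 1) * ((α - 1) ^ (α - 1) * k)) * (2 / k)
      = 2 * α * ((d + 1) ^ (α - 1) * (α - 1) ^ (α - 1)) := by field_simp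
  linarith

/-- Change of variables `y = exp ((log x) ^ α) (log x) ^ d`. -/
theorem lintegral_exp_log_rpow_le {α : ℝ} (hα : 1 < α) (d : ℕ) (U : ℝ → ℝ≥0∞) :
    ∫⁻ x in Ioi (Real.exp 1),
      ENNReal.ofReal (Real.exp (Real.log x ^ α) * Real.log x ^ (α - 1) / x * Real.log x ^ d)
        * U (Real.exp (Real.log x ^ α) * Real.log x ^ d)
      ≤ ∫⁻ y in Ioi (0 : ℝ), U y := by
  have hpos : ∀ x ∈ Ioi (Real.exp 1), 0 < x ∧ 1 < Real.log x := fun x hx => by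
    have h0 : 0 < x := (Real.exp_pos 1).trans hx
    exact ⟨h0, (Real.lt_log_iff_exp_lt h0).2 hx⟩
  let f : ℝ → ℝ := fun x => Real.exp (Real.log x ^ α) * Real.log x ^ d
  let f' : ℝ → ℝ := fun x =>
    Real.exp (Real.log x ^ α) * (x⁻¹ * α * Real.log x ^ (α - 1)) * Real.log x ^ d
      + Real.exp (Real.log x ^ α) * (d * Real.log x ^ (d - 1) * x⁻¹)
  have hf' : ∀ x ∈ Ioi (Real.exp 1), HasDerivWithinAt f (f' x) (Ioi (Real.exp 1)) x := by
    intro x hx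
    obtain ⟨h0, h1⟩ := hpos x hx
    have hl := Real.hasDerivAt_log h0.ne'
    have h2 := (hl.rpow_const (p := α) (Or.inl (by linarith))).exp
    exact (h2.mul (hl.pow d)).hasDerivWithinAt
  have hinj : InjOn f (Ioi (Real.exp 1)) := by
    refine StrictMonoOn.injOn fun x hx y hy hxy => ?_
    obtain ⟨hx0, hx1⟩ := hpos x hx
    have hl := Real.log_lt_log hx0 hxy
    have h1 : Real.exp (Real.log x ^ α) < Real.exp (Real.log y ^ α) :=
      Real.exp_lt_exp.2 (Real.rpow_lt_rpow (by linarith) hl (by linarith))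
    have h2 : Real.log x ^ d ≤ Real.log y ^ d := by gcongr
    exact mul_lt_mul h1 h2 (by positivity) (by positivity)
  calc _ ≤ ∫⁻ x in Ioi (Real.exp 1), ENNReal.ofReal |f' x| * U (f x) := by
        refine setLIntegral_mono' measurableSet_Ioi fun x hx => ?_
        obtain ⟨h0, h1⟩ := hpos x hx
        have hl0 : 0 < Real.log x := by linarith
        gcongr
        -- Of the two nonnegative terms of the derivative only the one from the exponential is kept,
        -- and its factor `α ≥ 1` is dropped.
        refine le_trans ?_ (le_abs_self _)
        have h3 : 0 ≤ Real.exp (Real.log x ^ α) * (d * Real.log x ^ (d - 1) * x⁻¹) := by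
          positivity
        have h4 : Real.exp (Real.log x ^ α) * (x⁻¹ * α * Real.log x ^ (α - 1)) * Real.log x ^ d
            = α * (Real.exp (Real.log x ^ α) * Real.log x ^ (α - 1) / x * Real.log x ^ d) := by
          rw [div_eq_mul_inv]; ring
        have h5 : 0 ≤ Real.exp (Real.log x ^ α) * Real.log x ^ (α - 1) / x * Real.log x ^ d := by
          positivity
        simp only [f']
        rw [h4]
        nlinarith
    _ = ∫⁻ y in f '' Ioi (Real.exp 1), U y :=
        (lintegral_image_eq_lintegral_abs_deriv_mul measurableSet_Ioi hf' hinj U).symm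
    _ ≤ _ := by
        refine lintegral_mono_set ?_
        rintro _ ⟨x, hx, rfl⟩
        obtain ⟨h0, h1⟩ := hpos x hx
        have hl0 : 0 < Real.log x := by linarith
        exact mem_Ioi.2 (by positivity)

theorem tsum_tail_lt_top {α : ℝ} (hα : 1 < α) (d : ℕ) {W U : ℝ → ℝ≥0∞} (hW : Antitone W)
    (hW1 : ∀ x, W x ≤ 1)
    (hWU : ∀ x, 1 ≤ x → W x ≤ U (Real.exp (Real.log x ^ α) * Real.log x ^ d))
    (hU : ∫⁻ y in Ioi (0 : ℝ), U y < ⊤) :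
    ∑' n : Fin (d + 1) → ℕ+,
      ENNReal.ofReal (Real.exp (Real.log (size n) ^ α) * Real.log (size n) ^ (α - 1) / size n)
        * W (size n) < ⊤ := by
  have hα1 : 0 < α - 1 := by linarith
  set C : ℝ := 2 * Real.exp (2 * α * ((d + 1) ^ (α - 1) * (α - 1) ^ (α - 1))) with hC
  have hC0 : 0 < C := by positivity
  let T : ℝ → ℝ≥0∞ := fun y =>
    ENNReal.ofReal (Real.exp (Real.log y ^ α) * Real.log y ^ (α - 1) / y) * W y
  -- `1 + log x` replaces `log x` since `p k ≤ 2 x` gives `log (p k) ≤ log 2 + log x`; a constant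
  -- multiple of `log x` would fail near `x = 1`.
  let F : ℝ → ℝ≥0∞ := fun x =>
    ENNReal.ofReal (C * (Real.exp (Real.log x ^ α) * (1 + Real.log x) ^ (α - 1) / x)) * W x
  have hF : Measurable F := by
    have := hW.measurable
    fun_prop
  have hT1 : T 1 = 0 := by simp [T, Real.zero_rpow hα1.ne']
  refine (tsum_size_le (T := T) (d := d) hF hT1 ?_).trans_lt ?_
  · rintro p k hp hk hpk x ⟨hx, hx'⟩
    have hx1 : 1 ≤ x := by nlinarith
    have hx0 : 0 < x := by linarith
    have hle : Real.log x ≤ Real.log (p * k) := Real.log_le_log hx0 hx'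
    have hlx := Real.log_nonneg hx1
    have hly := hlx.trans hle
    simp only [T, F]
    gcongr ?_ * ?_
    · refine ENNReal.ofReal_le_ofReal ?_
      have h1 := exp_log_rpow_le hα d hp hk hpk hx.le hx'
      have h2 : Real.log (p * k) ≤ 1 + Real.log x := by
        have h3 : p * k ≤ 2 * x := by nlinarith
        have h4 := Real.log_le_log (by positivity) h3
        rw [Real.log_mul (by norm_num) hx0.ne'] at h4
        have := Real.log_two_lt_d9
        linarith
      have h5 : (p * k)⁻¹ ≤ 2 * x⁻¹ := by
        rw [← div_eq_mul_inv, le_div_iff₀ hx0, inv_mul_le_iff₀ (by positivity)]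
        linarith
      rw [div_eq_mul_inv, div_eq_mul_inv]
      calc _ ≤ (Real.exp (2 * α * ((d + 1) ^ (α - 1) * (α - 1) ^ (α - 1)))
              * Real.exp (Real.log x ^ α)) * (1 + Real.log x) ^ (α - 1) * (2 * x⁻¹) := by
            gcongr
        _ = _ := by rw [hC]; ring
    · exact hW hx'
  refine ENNReal.mul_lt_top (by finiteness) ?_
  -- On `(1, e]` the integrand is bounded; beyond `e`, `1 + log x ≤ 2 log x` and the change of
  -- variables applies.
  have hunion : Ioi (1 : ℝ) = Ioc 1 (Real.exp 1) ∪ Ioi (Real.exp 1) :=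
    (Ioc_union_Ioi_eq_Ioi (Real.one_le_exp zero_le_one)).symm
  rw [hunion]
  refine (lintegral_union_le _ _ _).trans_lt (ENNReal.add_lt_top.2 ⟨?_, ?_⟩)
  · refine (setLIntegral_mono' measurableSet_Ioc (g := fun _ => ENNReal.ofReal 2 ^ d *
      (ENNReal.ofReal (C * (Real.exp 1 * 2 ^ (α - 1) / 1)) * 1)) fun x hx => ?_).trans_lt ?_
    · have hx0 : 0 < x := by linarith [hx.1]
      have hl0 := Real.log_nonneg hx.1.le
      have hl1 : Real.log x ≤ 1 := (Real.log_le_iff_le_exp hx0).2 hx.2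
      have h1 : Real.log x ^ α ≤ 1 := Real.rpow_le_one hl0 hl1 (by linarith)
      simp only [F]
      gcongr
      · linarith
      · linarith
      · exact hx.1.le
      · exact hW1 x
    · rw [setLIntegral_const, Real.volume_Ioc]
      finiteness
  · set K : ℝ := 2 ^ d * C * 2 ^ (α - 1) with hK
    calc _ ≤ ∫⁻ x in Ioi (Real.exp 1), ENNReal.ofReal K * (ENNReal.ofReal
            (Real.exp (Real.log x ^ α) * Real.log x ^ (α - 1) / x * Real.log x ^ d)
            * U (Real.exp (Real.log x ^ α) * Real.log x ^ d)) := by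
          refine setLIntegral_mono' measurableSet_Ioi fun x hx => ?_
          have hx0 : 0 < x := (Real.exp_pos 1).trans hx
          have hx1 : 1 ≤ x := (Real.one_le_exp zero_le_one).trans (le_of_lt hx)
          have hl1 : 1 < Real.log x := (Real.lt_log_iff_exp_lt hx0).2 hx
          have hl0 : 0 < Real.log x := by linarith
          simp only [F]
          rw [← mul_assoc, ← mul_assoc, ← ENNReal.ofReal_pow (by positivity),
            ← ENNReal.ofReal_mul (by positivity), ← ENNReal.ofReal_mul (by positivity)]
          gcongr ?_ * ?_
          · refine ENNReal.ofReal_le_ofReal ?_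
            calc _ ≤ (2 * Real.log x) ^ d
                  * (C * (Real.exp (Real.log x ^ α) * (2 * Real.log x) ^ (α - 1) / x)) := by
                  gcongr <;> linarith
              _ = _ := by
                  rw [Real.mul_rpow (by norm_num) hl0.le, mul_pow, hK]; ring
          · exact hWU x hx1
      _ = ENNReal.ofReal K * ∫⁻ x in Ioi (Real.exp 1), ENNReal.ofReal
            (Real.exp (Real.log x ^ α) * Real.log x ^ (α - 1) / x * Real.log x ^ d)
            * U (Real.exp (Real.log x ^ α) * Real.log x ^ d) :=
          lintegral_const_mul' _ _ ENNReal.ofReal_ne_top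
      _ < ⊤ := ENNReal.mul_lt_top ENNReal.ofReal_lt_top
          ((lintegral_exp_log_rpow_le hα d U).trans_lt hU)

/-! ### Moment generating function of a truncated variable. -/

/-- No lower bound on `u` is imposed because the variables are truncated only from above. -/
theorem exp_le_one_add_add_sq {u : ℝ} (hu : u ≤ 1) : Real.exp u ≤ 1 + u + u ^ 2 := by
  rcases le_total (-1) u with h | h
  · have := (abs_le.1 (Real.abs_exp_sub_one_sub_id_le (abs_le.2 ⟨h, hu⟩))).2
    linarith
  · have := Real.exp_le_one_iff.2 (by linarith : u ≤ 0)
    nlinarith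

/-- The tilting parameter of the exponential inequality. -/
noncomputable def tilt (α l N : ℝ) : ℝ := l * Real.log N ^ α / N

/-- Used twice: `h x > 1` forces `x > √N`, and `h ^ 2 ≤ 1 / N`. -/
theorem tilt_mul_sqrt_le_one {α l N : ℝ} (hN : 0 < N) (h : l * Real.log N ^ α ≤ √N) :
    tilt α l N * √N ≤ 1 := by
  have h1 : √N * √N = N := Real.mul_self_sqrt hN.le
  have : tilt α l N * √N = l * Real.log N ^ α / √N := by
    unfold tilt
    nth_rewrite 2 [← h1]
    field_simp
  rw [this]
  exact (div_le_one (by positivity)).2 h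

/-- The function `log y / y ^ (1 / α)` decreases on `[e ^ α, ∞)`; raise to the power `α`. -/
theorem log_rpow_mul_le {α y N : ℝ} (hα : 0 < α) (hy : Real.exp α ≤ y) (hyN : y ≤ N) :
    Real.log N ^ α / N * y ≤ Real.log y ^ α := by
  have hy0 : 0 < y := (Real.exp_pos α).trans_le hy
  have hN0 : 0 < N := hy0.trans_le hyN
  have hy1 : 1 ≤ y := (Real.one_le_exp hα.le).trans hy
  have hly := Real.log_nonneg hy1
  have hlN := Real.log_nonneg (hy1.trans hyN)
  have h := Real.log_div_self_rpow_antitoneOn (inv_pos.2 hα) (a := α⁻¹)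
    (by simpa using hy) (by simpa using hy.trans hyN) hyN
  simp only at h
  have h2 := Real.rpow_le_rpow (by positivity) h hα.le
  rw [Real.div_rpow hlN (by positivity), Real.div_rpow hly (by positivity),
    ← Real.rpow_mul hN0.le, ← Real.rpow_mul hy0.le, inv_mul_cancel₀ hα.ne', Real.rpow_one,
    Real.rpow_one, le_div_iff₀ hy0] at h2
  exact h2

/-- If `h x ≤ 1`, expand to second order. Otherwise `x > √N`, and the exponent is at most `l (log x)
^ α`; the missing share `(1 - l) (log x) ^ α` is at least `(1 - l) (log N / 2) ^ α`, which gives the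
small factor. -/
theorem exp_tilt_mul_min_le {α l N : ℝ} (hα : 1 < α) (hl0 : 0 < l) (hl1 : l < 1)
    (h1 : l * Real.log N ^ α ≤ √N) (h2 : Real.exp α ≤ √N) (x : ℝ) :
    Real.exp (tilt α l N * min x N)
      ≤ 1 + tilt α l N * x + tilt α l N ^ 2 * x ^ 2
        + Real.exp (-((1 - l) * (Real.log N / 2) ^ α)) * Real.exp (Real.posLog x ^ α) := by
  have hs1 : 1 < √N := (Real.one_lt_exp_iff.2 (by linarith)).trans_le h2
  have hs0 : 0 < √N := by linarith
  have hN0 : 0 < N := Real.sqrt_pos.1 hs0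
  have hsq : √N * √N = N := Real.mul_self_sqrt hN0.le
  have hsN : √N ≤ N := by nlinarith
  have hlN : 0 < Real.log N := Real.log_pos (by linarith)
  have hh0 : 0 < tilt α l N := by unfold tilt; positivity
  have hh1 := tilt_mul_sqrt_le_one hN0 h1
  set h := tilt α l N with hh
  rcases le_or_gt (h * x) 1 with hx | hx
  · have h3 : Real.exp (h * min x N) ≤ Real.exp (h * x) := by
      gcongr
      exact min_le_left _ _
    have h4 := exp_le_one_add_add_sq hx
    have h5 : 0 ≤ Real.exp (-((1 - l) * (Real.log N / 2) ^ α)) * Real.exp (Real.posLog x ^ α) := by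
      positivity
    rw [mul_pow] at h4
    linarith
  · have hxs : √N < x := lt_of_mul_lt_mul_left (hh1.trans_lt hx) hh0.le
    have hx0 : 0 < x := by linarith
    have hys : √N ≤ min x N := le_min hxs.le hsN
    have hy0 : 0 < min x N := hs0.trans_le hys
    have hlx : Real.log N / 2 ≤ Real.log x := by
      rw [← Real.log_sqrt hN0.le]
      exact Real.log_le_log hs0 hxs.le
    have hpos : Real.posLog x = Real.log x := max_eq_right (by linarith)
    have h3 : h * min x N ≤ l * Real.log x ^ α := by
      calc h * min x N = l * (Real.log N ^ α / N * min x N) := by rw [hh, tilt]; ring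
        _ ≤ l * Real.log (min x N) ^ α := by
            gcongr
            exact log_rpow_mul_le (by linarith) (h2.trans hys) (min_le_right _ _)
        _ ≤ l * Real.log x ^ α := by
            gcongr
            · exact Real.log_nonneg (hs1.le.trans hys)
            · exact min_le_left _ _
    have h4 : (Real.log N / 2) ^ α ≤ Real.log x ^ α := by gcongr
    have h5 : Real.exp (h * min x N)
        ≤ Real.exp (-((1 - l) * (Real.log N / 2) ^ α)) * Real.exp (Real.posLog x ^ α) := by
      rw [← Real.exp_add, hpos]
      gcongr
      nlinarith
    have h6 : 0 ≤ h * x := by positivity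
    have h7 : 0 ≤ h ^ 2 * x ^ 2 := by positivity
    linarith

/-- The third condition makes that small factor at most `1 / N`; it holds eventually because `α >
1`. -/
theorem eventually_tilt {α l : ℝ} (hα : 1 < α) (hl1 : l < 1) :
    ∀ᶠ N : ℝ in atTop, l * Real.log N ^ α ≤ √N ∧ Real.exp α ≤ √N
      ∧ Real.log N ≤ (1 - l) * (Real.log N / 2) ^ α := by
  have hα1 : 0 < α - 1 := by linarith
  have hl : 0 < 1 - l := by linarith
  refine Filter.Eventually.and ?_ (Filter.Eventually.and ?_ ?_)
  · have h := (isLittleO_log_rpow_rpow_atTop α (by norm_num : (0 : ℝ) < 1 / 2)).bound one_pos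
    filter_upwards [h, eventually_ge_atTop 1] with N hN hN1
    have hlog := Real.log_nonneg hN1
    rw [Real.norm_of_nonneg (by positivity), Real.norm_of_nonneg (by positivity), one_mul,
      ← Real.sqrt_eq_rpow] at hN
    have : 0 ≤ Real.log N ^ α := by positivity
    nlinarith
  · exact Real.tendsto_sqrt_atTop.eventually_ge_atTop _
  · have ht : Tendsto (fun N : ℝ => (1 - l) * (Real.log N / 2) ^ (α - 1)) atTop atTop :=
      ((tendsto_rpow_atTop hα1).comp
        (Real.tendsto_log_atTop.atTop_div_const two_pos)).const_mul_atTop hl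
    filter_upwards [ht.eventually_ge_atTop 2, eventually_gt_atTop 1] with N hN hN1
    have hlog := Real.log_pos hN1
    have : (Real.log N / 2) ^ α = (Real.log N / 2) ^ (α - 1) * (Real.log N / 2) := by
      rw [Real.rpow_sub_one (by positivity)]
      field_simp
    rw [this, ← mul_assoc]
    nlinarith

theorem exists_sq_le_exp_posLog_rpow {α : ℝ} (hα : 1 < α) :
    ∃ K : ℝ, 0 < K ∧ ∀ x : ℝ, x ^ 2 ≤ K * Real.exp (Real.posLog x ^ α) := by
  have hα1 : 0 < α - 1 := by linarith
  -- The threshold beyond which `t ^ α ≥ 2 t`; below it `2 t ≤ 2 r` goes into the constant.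
  set r : ℝ := 2 ^ (α - 1)⁻¹ with hr
  have hr0 : 0 < r := by positivity
  refine ⟨Real.exp (2 * r), by positivity, fun x => ?_⟩
  have h1 : x ^ 2 ≤ Real.exp (2 * Real.posLog x) := by
    rcases eq_or_ne x 0 with rfl | hx
    · simp
    · have h2 : Real.log (x ^ 2) = 2 * Real.log x := by rw [Real.log_pow]; norm_num
      rw [← Real.log_le_iff_le_exp (by positivity), h2]
      gcongr
      exact le_max_right _ _
  refine h1.trans ?_
  rw [← Real.exp_add]
  gcongr
  set t := Real.posLog x
  have ht : 0 ≤ t := Real.posLog_nonneg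
  rcases le_total t r with h | h
  · have : 0 ≤ t ^ α := by positivity
    linarith
  · have ht0 : 0 < t := hr0.trans_le h
    have h3 : 2 ≤ t ^ (α - 1) := by
      calc (2 : ℝ) = r ^ (α - 1) := by
            rw [hr, ← Real.rpow_mul (by norm_num), inv_mul_cancel₀ hα1.ne', Real.rpow_one]
        _ ≤ _ := by gcongr
    have h4 : t ^ α = t ^ (α - 1) * t := by
      rw [Real.rpow_sub_one ht0.ne']; field_simp
    nlinarith

theorem measurable_exp_posLog_rpow (α : ℝ) :
    Measurable fun x : ℝ => Real.exp (Real.posLog x ^ α) := by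
  unfold Real.posLog
  fun_prop

variable {Ω : Type*} [MeasurableSpace Ω]

theorem integrable_of_exp_posLog_rpow {α : ℝ} (hα : 1 < α) {P : Measure Ω}
    [IsProbabilityMeasure P] {Y : Ω → ℝ} (hY : Measurable Y)
    (hint : Integrable (fun ω => Real.exp (Real.posLog (Y ω) ^ α)) P) :
    Integrable (fun ω => Y ω ^ 2) P ∧ Integrable Y P := by
  obtain ⟨K, hK, h⟩ := exists_sq_le_exp_posLog_rpow hα
  have h2 : Integrable (fun ω => Y ω ^ 2) P :=
    (hint.const_mul K).mono' (by fun_prop) (ae_of_all _ fun ω => by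
      rw [Real.norm_of_nonneg (by positivity)]; exact h _)
  refine ⟨h2, ((integrable_const (1 : ℝ)).add h2).mono' (by fun_prop) (ae_of_all _ fun ω => ?_)⟩
  rw [Real.norm_eq_abs, Pi.add_apply, ← sq_abs]
  nlinarith [sq_nonneg (|Y ω| - 1), abs_nonneg (Y ω)]

/-- The moment generating function of a truncated centred random variable whose
`exp ((log⁺ |Y|) ^ α)` is integrable. -/
theorem eventually_lintegral_exp_tilt_le {α l : ℝ} (hα : 1 < α) (hl0 : 0 < l) (hl1 : l < 1)
    {M : ℝ} (hM : 0 ≤ M) :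
    ∃ c : ℝ, 0 ≤ c ∧ ∀ᶠ N : ℝ in atTop, ∀ (P : Measure Ω) [IsProbabilityMeasure P] (Y : Ω → ℝ),
      Measurable Y → ∫⁻ ω, ENNReal.ofReal (Real.exp (Real.posLog (Y ω) ^ α)) ∂P ≤ ENNReal.ofReal M →
      ∫ ω, Y ω ∂P ≤ 0 →
      ∫⁻ ω, ENNReal.ofReal (Real.exp (tilt α l N * min (Y ω) N)) ∂P
        ≤ ENNReal.ofReal (Real.exp (c / N)) := by
  obtain ⟨K, hK, hsq⟩ := exists_sq_le_exp_posLog_rpow hα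
  -- `K M` comes from the second moment times `h ^ 2 ≤ 1 / N`, `M` from the exponential moment times
  -- `δ ≤ 1 / N`.
  refine ⟨K * M + M, by positivity, ?_⟩
  filter_upwards [eventually_tilt hα hl1, eventually_ge_atTop 1] with N hN hN1 P _ Y hY hexp hmean
  obtain ⟨h1, h2, h3⟩ := hN
  have hN0 : 0 < N := by linarith
  have hlN := Real.log_nonneg hN1
  have hmeas : Measurable fun ω => Real.exp (Real.posLog (Y ω) ^ α) :=
    (measurable_exp_posLog_rpow α).comp hY
  have hint : Integrable (fun ω => Real.exp (Real.posLog (Y ω) ^ α)) P :=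
    ⟨hmeas.aestronglyMeasurable, by
      rw [hasFiniteIntegral_iff_ofReal (ae_of_all _ fun _ => by positivity)]
      exact hexp.trans_lt ENNReal.ofReal_lt_top⟩
  obtain ⟨hint2, hint1⟩ := integrable_of_exp_posLog_rpow hα hY hint
  have hM' : ∫ ω, Real.exp (Real.posLog (Y ω) ^ α) ∂P ≤ M := by
    rw [← ENNReal.ofReal_le_ofReal_iff hM,
      ofReal_integral_eq_lintegral_ofReal hint (ae_of_all _ fun _ => by positivity)]
    exact hexp
  have hvar : ∫ ω, Y ω ^ 2 ∂P ≤ K * M := by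
    calc _ ≤ ∫ ω, K * Real.exp (Real.posLog (Y ω) ^ α) ∂P :=
          integral_mono hint2 (hint.const_mul K) fun ω => hsq _
      _ ≤ _ := by rw [integral_const_mul]; gcongr
  have hh1 := tilt_mul_sqrt_le_one hN0 h1
  have hh0 : 0 ≤ tilt α l N := by unfold tilt; positivity
  set h := tilt α l N with hh
  set δ := Real.exp (-((1 - l) * (Real.log N / 2) ^ α)) with hδ
  have hδN : δ ≤ 1 / N := by
    rw [hδ, one_div, ← Real.exp_log (inv_pos.2 hN0), Real.log_inv]
    gcongr
  have hhN : h ^ 2 ≤ 1 / N := by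
    rw [le_div_iff₀ hN0, ← Real.sq_sqrt hN0.le, ← mul_pow]
    exact pow_le_one₀ (by positivity) hh1
  have i1 : Integrable (fun ω => 1 + h * Y ω) P := (integrable_const _).add (hint1.const_mul h)
  have i2 : Integrable (fun ω => 1 + h * Y ω + h ^ 2 * Y ω ^ 2) P := i1.add (hint2.const_mul _)
  have hg : Integrable (fun ω => 1 + h * Y ω + h ^ 2 * Y ω ^ 2
      + δ * Real.exp (Real.posLog (Y ω) ^ α)) P := i2.add (hint.const_mul δ)
  have hle := exp_tilt_mul_min_le hα hl0 hl1 h1 h2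
  have hnn : ∀ ω, 0 ≤ 1 + h * Y ω + h ^ 2 * Y ω ^ 2 + δ * Real.exp (Real.posLog (Y ω) ^ α) :=
    fun ω => (Real.exp_pos _).le.trans (hle (Y ω))
  calc _ ≤ ∫⁻ ω, ENNReal.ofReal (1 + h * Y ω + h ^ 2 * Y ω ^ 2
        + δ * Real.exp (Real.posLog (Y ω) ^ α)) ∂P :=
        lintegral_mono fun ω => ENNReal.ofReal_le_ofReal (hle (Y ω))
    _ = ENNReal.ofReal (∫ ω, (1 + h * Y ω + h ^ 2 * Y ω ^ 2
        + δ * Real.exp (Real.posLog (Y ω) ^ α)) ∂P) :=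
        (ofReal_integral_eq_lintegral_ofReal hg (ae_of_all _ hnn)).symm
    _ ≤ _ := by
        refine ENNReal.ofReal_le_ofReal ?_
        rw [integral_add i2 (hint.const_mul δ), integral_add i1 (hint2.const_mul _),
          integral_add (integrable_const _) (hint1.const_mul h), integral_const_mul,
          integral_const_mul, integral_const_mul]
        have e1 : h * ∫ ω, Y ω ∂P ≤ 0 := mul_nonpos_of_nonneg_of_nonpos hh0 hmean
        have e2 : h ^ 2 * ∫ ω, Y ω ^ 2 ∂P ≤ 1 / N * (K * M) := by gcongr
        have e3 : δ * ∫ ω, Real.exp (Real.posLog (Y ω) ^ α) ∂P ≤ 1 / N * M := by gcongr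
        have e4 := Real.add_one_le_exp ((K * M + M) / N)
        have e5 : (K * M + M) / N = 1 / N * (K * M) + 1 / N * M := by ring
        simp only [integral_const, probReal_univ, smul_eq_mul, mul_one]
        linarith

/-! ### Bounded Lipschitz test functions. -/

/-- Bounded Lipschitz functions. -/
def BddLip {V : Type*} [NormedAddCommGroup V] (φ : V → ℝ) : Prop :=
  ∃ B : ℝ, 0 ≤ B ∧ (∀ x, |φ x| ≤ B) ∧ ∀ x y, |φ x - φ y| ≤ B * ‖x - y‖

theorem BddLip.locLip {V : Type*} [NormedAddCommGroup V] {φ : V → ℝ} (h : BddLip φ) :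
    LocLip φ := by
  obtain ⟨B, hB, -, hl⟩ := h
  refine ⟨B + 1, by positivity, 0, fun x y => (hl x y).trans ?_⟩
  gcongr
  norm_num
  linarith

/-- Boundedness makes the Lipschitz class stable under products, as needed to test independence on
products of exponentials. -/
theorem BddLip.mul {V : Type*} [NormedAddCommGroup V] {φ ψ : V → ℝ} (h : BddLip φ)
    (h' : BddLip ψ) : BddLip fun x => φ x * ψ x := by
  obtain ⟨B, hB, hb, hl⟩ := h
  obtain ⟨B', hB', hb', hl'⟩ := h'
  refine ⟨2 * (B * B'), by positivity, fun x => ?_, fun x y => ?_⟩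
  · rw [abs_mul]
    have : |φ x| * |ψ x| ≤ B * B' := by gcongr; exacts [hb x, hb' x]
    nlinarith [mul_nonneg hB hB']
  · have e : φ x * ψ x - φ y * ψ y = φ x * (ψ x - ψ y) + ψ y * (φ x - φ y) := by ring
    rw [e]
    calc _ ≤ |φ x * (ψ x - ψ y)| + |ψ y * (φ x - φ y)| := abs_add_le _ _
      _ = |φ x| * |ψ x - ψ y| + |ψ y| * |φ x - φ y| := by rw [abs_mul, abs_mul]
      _ ≤ B * (B' * ‖x - y‖) + B' * (B * ‖x - y‖) := by
          gcongr
          exacts [hb x, hl' x y, hb' y, hl x y]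
      _ = _ := by ring

theorem BddLip.prod {V κ : Type*} [NormedAddCommGroup V] {φ : κ → V → ℝ} (h : ∀ k, BddLip (φ k))
    (s : Finset κ) : BddLip fun x => ∏ k ∈ s, φ k x := by
  classical
  induction s using Finset.induction_on with
  | empty => exact ⟨1, by simp, by simp, by simp⟩
  | insert a s ha ih =>
    simp_rw [Finset.prod_insert ha]
    exact (h a).mul ih

theorem BddLip.comp {V W : Type*} [NormedAddCommGroup V] [NormedAddCommGroup W] {φ : W → ℝ}
    (h : BddLip φ) {L : V → W} (hL : ∀ x y, ‖L x - L y‖ ≤ ‖x - y‖) : BddLip fun x => φ (L x) := by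
  obtain ⟨B, hB, hb, hl⟩ := h
  exact ⟨B, hB, fun x => hb _, fun x y => (hl _ _).trans (by gcongr; exact hL x y)⟩

theorem BddLip.comp_apply {ι : Type*} [Fintype ι] {φ : ℝ → ℝ} (h : BddLip φ) (i : ι) :
    BddLip fun x : ι → ℝ => φ (x i) :=
  h.comp fun x y => by simpa using norm_le_pi_norm (x - y) i

/-- Truncation from above bounds the exponential by `exp (h N)`; the Lipschitz bound follows from
the tangent inequality `e ^ a - e ^ b ≤ e ^ a (a - b)`. -/
theorem bddLip_exp_mul_min {h N s : ℝ} (hh : 0 ≤ h) (hs : |s| ≤ 1) :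
    BddLip fun x : ℝ => Real.exp (h * min (s * x) N) := by
  have hle : ∀ x, Real.exp (h * min (s * x) N) ≤ Real.exp (h * N) := fun x => by
    gcongr; exact min_le_right (s * x) N
  have hmin : ∀ x y, h * min (s * x) N - h * min (s * y) N ≤ h * ‖x - y‖ := fun x y => by
    rw [← mul_sub]
    gcongr
    refine (le_abs_self _).trans ((abs_min_sub_min_le_max _ _ _ _).trans ?_)
    rw [sub_self, abs_zero, max_eq_left (abs_nonneg _), ← mul_sub, abs_mul, Real.norm_eq_abs]
    exact mul_le_of_le_one_left (abs_nonneg _) hs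
  have hone : ∀ x y, Real.exp (h * min (s * x) N) - Real.exp (h * min (s * y) N)
      ≤ Real.exp (h * N) * (h * ‖x - y‖) := fun x y => by
    set a := h * min (s * x) N
    set b := h * min (s * y) N
    have e1 : Real.exp b = Real.exp a * Real.exp (b - a) := by rw [← Real.exp_add]; ring_nf
    have e2 := Real.add_one_le_exp (b - a)
    have e3 : Real.exp a * (b - a + 1) ≤ Real.exp a * Real.exp (b - a) := by gcongr
    have e4 : Real.exp a * (h * ‖x - y‖) ≤ Real.exp (h * N) * (h * ‖x - y‖) :=
      mul_le_mul_of_nonneg_right (hle x) (by positivity)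
    have e5 : Real.exp a * (a - b) ≤ Real.exp a * (h * ‖x - y‖) := by gcongr; exact hmin x y
    linarith
  refine ⟨Real.exp (h * N) * (1 + h), by positivity, fun x => ?_, fun x y => ?_⟩
  · rw [abs_of_pos (Real.exp_pos _)]
    exact (hle x).trans (le_mul_of_one_le_right (by positivity) (by linarith))
  · have e : Real.exp (h * N) * (h * ‖x - y‖) ≤ Real.exp (h * N) * (1 + h) * ‖x - y‖ := by
      rw [mul_assoc]
      gcongr
      linarith
    rw [abs_le]
    have h1 := hone x y
    have h2 := hone y x
    rw [norm_sub_rev] at h2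
    constructor <;> linarith

theorem bddLip_ramp (N : ℝ) (m : ℕ) :
    BddLip fun x : ℝ => min (m * max (|x| - N) 0) 1 := by
  refine ⟨m + 1, by positivity, fun x => ?_, fun x y => ?_⟩
  · rw [abs_of_nonneg (by positivity)]
    have : (0 : ℝ) ≤ m := by positivity
    exact (min_le_right _ _).trans (by linarith)
  · refine (abs_min_sub_min_le_max _ _ _ _).trans ?_
    rw [sub_self, abs_zero, max_eq_left (abs_nonneg _), ← mul_sub, abs_mul, Nat.abs_cast]
    have h1 : |max (|x| - N) 0 - max (|y| - N) 0| ≤ ‖x - y‖ := by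
      refine (abs_max_sub_max_le_max _ _ _ _).trans ?_
      rw [sub_self, abs_zero, max_eq_left (abs_nonneg _), sub_sub_sub_cancel_right]
      exact abs_abs_sub_abs_le_abs_sub x y
    gcongr
    linarith

/-! ### Transfer between the sub-linear expectation, the measures in `𝒬` and the capacity. -/

theorem SubLinearExpectation.comp_mem_of_bddLip (𝓔 : SubLinearExpectation Ω) {X : Ω → ℝ}
    (hX : X ∈ 𝓔.H) {φ : ℝ → ℝ} (hφ : BddLip φ) : (fun ω => φ (X ω)) ∈ 𝓔.H :=
  𝓔.comp_mem 1 (fun _ => X) (fun _ => hX) (fun x => φ (x 0)) (hφ.comp_apply 0).locLip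

theorem SubLinearExpectation.prod_mem (𝓔 : SubLinearExpectation Ω) {ι : Type*} {X : ι → Ω → ℝ}
    (hX : ∀ k, X k ∈ 𝓔.H) {φ : ℝ → ℝ} (hφ : BddLip φ) (s : Finset ι) :
    (fun ω => ∏ k ∈ s, φ (X k ω)) ∈ 𝓔.H := by
  have h := 𝓔.comp_mem s.card (fun i => X (s.equivFin.symm i)) (fun i => hX _)
    (fun x => ∏ i, φ (x i)) (BddLip.prod (fun i => hφ.comp_apply i) Finset.univ).locLip
  convert h using 2 with ω
  rw [s.equivFin.symm.prod_comp (fun k : s => φ (X k ω))]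
  exact (Finset.prod_coe_sort s fun k => φ (X k ω)).symm

theorem linExp_of_nonneg (P : ProbabilityMeasure Ω) {Y : Ω → ℝ} (hY : ∀ ω, 0 ≤ Y ω) :
    linExp P Y = ((∫⁻ ω, ENNReal.ofReal (Y ω) ∂(P : Measure Ω) : ℝ≥0∞) : EReal) := by
  have : ∀ ω, ENNReal.ofReal (-Y ω) = 0 := fun ω =>
    ENNReal.ofReal_of_nonpos (by linarith [hY ω])
  simp [linExp, this]

theorem linExp_of_integrable (P : ProbabilityMeasure Ω) {Y : Ω → ℝ}
    (hY : Integrable Y (P : Measure Ω)) : linExp P Y = ((∫ ω, Y ω ∂(P : Measure Ω) : ℝ) : EReal) := by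
  have h1 : ∫⁻ ω, ENNReal.ofReal (Y ω) ∂(P : Measure Ω) ≠ ⊤ := hY.lintegral_lt_top.ne
  have h2 : ∫⁻ ω, ENNReal.ofReal (-Y ω) ∂(P : Measure Ω) ≠ ⊤ := hY.neg.lintegral_lt_top.ne
  rw [integral_eq_lintegral_pos_part_sub_lintegral_neg_part hY, linExp, EReal.coe_sub]
  lift ∫⁻ ω, ENNReal.ofReal (Y ω) ∂(P : Measure Ω) to NNReal using h1 with a
  lift ∫⁻ ω, ENNReal.ofReal (-Y ω) ∂(P : Measure Ω) to NNReal using h2 with b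
  rfl

variable {𝓔 : SubLinearExpectation Ω} {𝒬 : Set (ProbabilityMeasure Ω)}

theorem Represents.linExp_le (h𝒬 : Represents 𝒬 𝓔) {Y : Ω → ℝ} (hY : Y ∈ 𝓔.H)
    {P : ProbabilityMeasure Ω} (hP : P ∈ 𝒬) : linExp P Y ≤ 𝓔.E Y := by
  rw [h𝒬 Y hY]
  exact le_iSup₂_of_le P hP le_rfl

theorem Represents.nonempty (h𝒬 : Represents 𝒬 𝓔) {Y : Ω → ℝ} (hY : Y ∈ 𝓔.H)
    (h : 𝓔.E Y = 0) : 𝒬.Nonempty := by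
  rw [Set.nonempty_iff_ne_empty]
  rintro rfl
  rw [h𝒬 Y hY] at h
  simp [upperExp] at h

theorem Represents.lintegral_le (h𝒬 : Represents 𝒬 𝓔) {Y : Ω → ℝ} (hY : Y ∈ 𝓔.H)
    (hY0 : ∀ ω, 0 ≤ Y ω) {P : ProbabilityMeasure Ω} (hP : P ∈ 𝒬) :
    ((∫⁻ ω, ENNReal.ofReal (Y ω) ∂(P : Measure Ω) : ℝ≥0∞) : EReal) ≤ 𝓔.E Y :=
  linExp_of_nonneg P hY0 ▸ h𝒬.linExp_le hY hP

theorem Represents.le_of_lintegral_le (h𝒬 : Represents 𝒬 𝓔) {Y : Ω → ℝ} (hY : Y ∈ 𝓔.H)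
    (hY0 : ∀ ω, 0 ≤ Y ω) {b : ℝ≥0∞}
    (h : ∀ P ∈ 𝒬, ∫⁻ ω, ENNReal.ofReal (Y ω) ∂(P : Measure Ω) ≤ b) : 𝓔.E Y ≤ (b : EReal) := by
  rw [h𝒬 Y hY]
  refine iSup₂_le fun P hP => ?_
  rw [linExp_of_nonneg P hY0]
  exact_mod_cast h P hP

/-- The upper expectation of a product over an independent identically distributed family. -/
theorem expectation_prod {ι : Type*} (o : LinearOrder ι) {X : ι → Ω → ℝ} (hX : ∀ k, X k ∈ 𝓔.H)
    (hind : ∀ (k : ι) (J : Finset ι), (∀ j ∈ J, j < k) →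
      IndepOf 𝓔 (fun _ : Unit => X k) (fun j : J => X j))
    {φ : ℝ → ℝ} (hφ : BddLip φ) (hφ0 : ∀ x, 0 ≤ φ x) {e : ℝ}
    (he : ∀ k, 𝓔.E (fun ω => φ (X k ω)) = e) (he0 : 0 ≤ e) (s : Finset ι) :
    𝓔.E (fun ω => ∏ k ∈ s, φ (X k ω)) = ((e ^ s.card : ℝ) : EReal) := by
  -- Independence goes one way only, so the largest index is split off.
  induction s using Finset.induction_on_max with
  | empty => simpa using 𝓔.const 1
  | insert a t hlt ih =>
    have hat : a ∉ t := fun h => lt_irrefl _ (hlt a h)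
    let ψ : (t → ℝ) × (Unit → ℝ) → ℝ := fun x => (∏ j, φ (x.1 j)) * φ (x.2 ())
    have hψ : BddLip ψ := by
      refine BddLip.mul ?_ ?_
      · exact (BddLip.prod (fun j : t => hφ.comp_apply j) Finset.univ).comp (L := Prod.fst)
          fun x y => norm_fst_le (x - y)
      · exact (hφ.comp_apply ()).comp (L := Prod.snd) fun x y => norm_snd_le (x - y)
    have hprod : ∀ ω, ∏ j : t, φ (X j ω) = ∏ k ∈ t, φ (X k ω) := fun ω =>
      Finset.prod_coe_sort t fun k => φ (X k ω)
    have h := hind a t hlt ψ hψ.locLip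
    simp only [ψ, hprod] at h
    have hpos : ∀ ω, 0 ≤ ∏ k ∈ t, φ (X k ω) := fun ω => Finset.prod_nonneg fun _ _ => hφ0 _
    -- Positive homogeneity pulls out the frozen product, which is nonnegative; the same rule then
    -- pulls `e` out of the outer expectation.
    have hin : ∀ ω, (𝓔.E fun ω' => (∏ k ∈ t, φ (X k ω)) * φ (X a ω')).toReal
        = e * ∏ k ∈ t, φ (X k ω) := fun ω => by
      rw [𝓔.pos_hom _ (𝓔.comp_mem_of_bddLip (hX a) hφ) _ (hpos ω), he, ← EReal.coe_mul,
        EReal.toReal_coe, mul_comm]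
    simp only [hin] at h
    rw [𝓔.pos_hom _ (𝓔.prod_mem hX hφ t) _ he0, ih, ← EReal.coe_mul] at h
    rw [Finset.card_insert_of_notMem hat, pow_succ', ← h]
    congr 1
    ext ω
    rw [Finset.prod_insert hat, mul_comm]

theorem capacity_le {A : Set Ω} {b : ℝ≥0∞} (h : ∀ P ∈ 𝒬, (P : Measure Ω) A ≤ b) :
    capacity 𝒬 A ≤ b := iSup₂_le h

theorem le_capacity {P : ProbabilityMeasure Ω} (hP : P ∈ 𝒬) (A : Set Ω) :
    (P : Measure Ω) A ≤ capacity 𝒬 A :=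
  le_iSup₂_of_le (f := fun (P : ProbabilityMeasure Ω) (_ : P ∈ 𝒬) => (P : Measure Ω) A) P hP le_rfl

theorem capacity_le_one (A : Set Ω) : capacity 𝒬 A ≤ 1 := capacity_le fun _ _ => prob_le_one

theorem capacity_mono {A B : Set Ω} (h : A ⊆ B) : capacity 𝒬 A ≤ capacity 𝒬 B :=
  capacity_le fun _ hP => (measure_mono h).trans (le_capacity hP B)

theorem capacity_union_le (A B : Set Ω) :
    capacity 𝒬 (A ∪ B) ≤ capacity 𝒬 A + capacity 𝒬 B :=
  capacity_le fun _ hP =>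
    (measure_union_le A B).trans (add_le_add (le_capacity hP A) (le_capacity hP B))

theorem capacity_biUnion_finset_le {ι : Type*} (s : Finset ι) (A : ι → Set Ω) :
    capacity 𝒬 (⋃ i ∈ s, A i) ≤ ∑ i ∈ s, capacity 𝒬 (A i) :=
  capacity_le fun _ hP =>
    (measure_biUnion_finset_le s A).trans (Finset.sum_le_sum fun i _ => le_capacity hP (A i))

/-- Indicators are not test functions, so the tail is approximated from below by Lipschitz ramps,
with monotone convergence under each measure. -/
theorem capacity_tail_le_of_identDist (h𝒬 : Represents 𝒬 𝓔) {X Y : Ω → ℝ} (hX : X ∈ 𝓔.H)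
    (hY : Y ∈ 𝓔.H) (h : IdentDist 𝓔 Y X) (N : ℝ) :
    capacity 𝒬 {ω | N < |Y ω|} ≤ capacity 𝒬 {ω | N < |X ω|} := by
  let φ : ℕ → ℝ → ℝ := fun m x => min (m * max (|x| - N) 0) 1
  have hφ : ∀ m, BddLip (φ m) := bddLip_ramp N
  have hφ0 : ∀ m x, 0 ≤ φ m x := fun m x => by simp only [φ]; positivity
  have hYm := 𝓔.measurable_of_mem Y hY
  have hXm := 𝓔.measurable_of_mem X hX
  have hset : ∀ {Z : Ω → ℝ}, Measurable Z → MeasurableSet {ω | N < |Z ω|} := fun hZ =>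
    measurableSet_lt measurable_const (measurable_abs.comp hZ)
  have bound : ∀ m, ∀ P ∈ 𝒬, ∫⁻ ω, ENNReal.ofReal (φ m (Y ω)) ∂(P : Measure Ω)
      ≤ capacity 𝒬 {ω | N < |X ω|} := by
    intro m P hP
    have h1 := h𝒬.lintegral_le (𝓔.comp_mem_of_bddLip hY (hφ m)) (fun ω => hφ0 m _) hP
    rw [h _ (hφ m).locLip] at h1
    have h2 := h𝒬.le_of_lintegral_le (𝓔.comp_mem_of_bddLip hX (hφ m)) (fun ω => hφ0 m _)
      (b := capacity 𝒬 {ω | N < |X ω|}) fun P' hP' => by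
        refine le_trans ?_ (le_capacity hP' _)
        rw [← lintegral_indicator_one (hset hXm)]
        refine lintegral_mono fun ω => ?_
        by_cases hω : N < |X ω|
        · rw [indicator_of_mem (by exact hω)]
          exact ENNReal.ofReal_le_one.2 (min_le_right _ _)
        · have : max (|X ω| - N) 0 = 0 := max_eq_right (by linarith)
          simp [φ, this]
    exact EReal.coe_ennreal_le_coe_ennreal_iff.1 (h1.trans h2)
  refine capacity_le fun P hP => ?_
  rw [← lintegral_indicator_one (hset hYm)]
  calc _ ≤ ∫⁻ ω, ⨆ m, ENNReal.ofReal (φ m (Y ω)) ∂(P : Measure Ω) := by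
        refine lintegral_mono fun ω => ?_
        by_cases hω : N < |Y ω|
        · rw [indicator_of_mem (by exact hω)]
          obtain ⟨m, hm⟩ := exists_nat_ge (1 / (|Y ω| - N))
          rw [div_le_iff₀ (by linarith)] at hm
          refine le_iSup_of_le m ?_
          have : φ m (Y ω) = 1 := by
            simp only [φ]
            rw [max_eq_left (by linarith), min_eq_right hm]
          simp [this]
        · rw [indicator_of_notMem (by exact hω)]
          exact zero_le
    _ = ⨆ m, ∫⁻ ω, ENNReal.ofReal (φ m (Y ω)) ∂(P : Measure Ω) := by
        refine lintegral_iSup (fun m => ?_) ?_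
        · exact (𝓔.measurable_of_mem _ (𝓔.comp_mem_of_bddLip hY (hφ m))).ennreal_ofReal
        · intro m m' hmm ω
          refine ENNReal.ofReal_le_ofReal ?_
          simp only [φ]
          gcongr
    _ ≤ _ := iSup_le fun m => bound m P hP

/-! ### Exponential Chebyshev inequality and the Choquet integral. -/

/-- The exponential Chebyshev inequality for truncated sums. -/
theorem capacity_sum_min_le (h𝒬 : Represents 𝒬 𝓔) {ι : Type*} {X : Ω → ℝ} (hX : X ∈ 𝓔.H)
    {Xf : ι → Ω → ℝ} (hXf : ∀ k, Xf k ∈ 𝓔.H) (hident : ∀ k, IdentDist 𝓔 (Xf k) X)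
    (hindep : IndepFamily 𝓔 Xf) {h N σ a b : ℝ} (hh : 0 ≤ h) (hσ : |σ| ≤ 1)
    (hb : ∀ P ∈ 𝒬, ∫⁻ ω, ENNReal.ofReal (Real.exp (h * min (σ * X ω) N)) ∂(P : Measure Ω)
      ≤ ENNReal.ofReal (Real.exp b)) (s : Finset ι) :
    capacity 𝒬 {ω | a < ∑ k ∈ s, min (σ * Xf k ω) N}
      ≤ ENNReal.ofReal (Real.exp (s.card * b - h * a)) := by
  set φ : ℝ → ℝ := fun x => Real.exp (h * min (σ * x) N) with hφ_def
  have hφ : BddLip φ := bddLip_exp_mul_min hh hσ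
  have hφ0 : ∀ x, 0 ≤ φ x := fun x => (Real.exp_pos _).le
  have hmem := 𝓔.comp_mem_of_bddLip hX hφ
  have hE0 : 0 ≤ 𝓔.E (fun ω => φ (X ω)) := by
    have h0 : (fun _ : Ω => (0 : ℝ)) ∈ 𝓔.H :=
      𝓔.comp_mem_of_bddLip hX (φ := fun _ => 0) ⟨0, by simp⟩
    have := 𝓔.mono _ hmem _ h0 fun ω => hφ0 _
    rwa [𝓔.const] at this
  have hEb : 𝓔.E (fun ω => φ (X ω)) ≤ (Real.exp b : ℝ) := by
    refine (h𝒬.le_of_lintegral_le hmem (fun ω => hφ0 _) hb).trans ?_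
    rw [EReal.coe_ennreal_ofReal, max_eq_left (Real.exp_pos b).le]
  obtain ⟨e, he⟩ : ∃ e : ℝ, 𝓔.E (fun ω => φ (X ω)) = e := by
    refine ⟨(𝓔.E (fun ω => φ (X ω))).toReal, (EReal.coe_toReal ?_ ?_).symm⟩
    · exact (hEb.trans_lt (EReal.coe_lt_top _)).ne
    · exact (lt_of_lt_of_le EReal.bot_lt_zero hE0).ne'
  rw [he] at hE0 hEb
  have he0 : 0 ≤ e := by exact_mod_cast hE0
  have heb : e ≤ Real.exp b := by exact_mod_cast hEb
  obtain ⟨o, ho⟩ := hindep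
  have hprod := expectation_prod o hXf ho hφ hφ0
    (fun k => (hident k φ hφ.locLip).trans he) he0 s
  refine capacity_le fun P hP => ?_
  -- Independence is not assumed under `P` itself; the product is evaluated under `𝓔.E`, which
  -- dominates `P`.
  have hPprod := h𝒬.lintegral_le (𝓔.prod_mem hXf hφ s)
    (fun ω => Finset.prod_nonneg fun _ _ => hφ0 _) hP
  rw [hprod, ← max_eq_left (pow_nonneg he0 s.card), ← EReal.coe_ennreal_ofReal,
    EReal.coe_ennreal_le_coe_ennreal_iff] at hPprod
  have hmeas : MeasurableSet {ω | a < ∑ k ∈ s, min (σ * Xf k ω) N} := by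
    refine measurableSet_lt measurable_const (Finset.measurable_sum _ fun k _ => ?_)
    exact ((𝓔.measurable_of_mem _ (hXf k)).const_mul σ).min measurable_const
  rw [← lintegral_indicator_one hmeas]
  calc _ ≤ ∫⁻ ω, ENNReal.ofReal (Real.exp (-(h * a))) * ENNReal.ofReal (∏ k ∈ s, φ (Xf k ω))
          ∂(P : Measure Ω) := by
        refine lintegral_mono fun ω => ?_
        by_cases hω : a < ∑ k ∈ s, min (σ * Xf k ω) N
        · rw [indicator_of_mem (by exact hω), ← ENNReal.ofReal_mul (Real.exp_pos _).le]
          simp only [φ]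
          rw [← Real.exp_sum, ← Real.exp_add, ← Finset.mul_sum, Pi.one_apply, ENNReal.one_le_ofReal]
          refine Real.one_le_exp ?_
          nlinarith
        · rw [indicator_of_notMem (by exact hω)]
          exact zero_le
    _ = ENNReal.ofReal (Real.exp (-(h * a))) * ∫⁻ ω, ENNReal.ofReal (∏ k ∈ s, φ (Xf k ω))
          ∂(P : Measure Ω) := lintegral_const_mul' _ _ ENNReal.ofReal_ne_top
    _ ≤ ENNReal.ofReal (Real.exp (-(h * a))) * ENNReal.ofReal (Real.exp b ^ s.card) := by
        gcongr
        exact hPprod.trans (ENNReal.ofReal_le_ofReal (by gcongr))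
    _ = _ := by
        rw [← ENNReal.ofReal_mul (Real.exp_pos _).le, ← Real.exp_nat_mul, ← Real.exp_add]
        ring_nf

/-- The negative part of the Choquet integral vanishes, since the whole space has capacity 1 when
`𝒬` is nonempty. -/
theorem lintegral_capacity_lt_top (h𝒬 : 𝒬.Nonempty) {Y : Ω → ℝ} (hY : ∀ ω, 0 ≤ Y ω)
    (h : choquet (capacity 𝒬) Y < ⊤) : ∫⁻ x in Ioi (0 : ℝ), capacity 𝒬 {ω | x < Y ω} < ⊤ := by
  obtain ⟨P, hP⟩ := h𝒬
  have h0 : ∫⁻ x in Iio (0 : ℝ), (1 - capacity 𝒬 {ω | x < Y ω}) = 0 := by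
    rw [setLIntegral_congr_fun measurableSet_Iio (g := fun _ => 0), lintegral_zero]
    intro x hx
    have h1 : {ω | x < Y ω} = univ := eq_univ_of_forall fun ω => lt_of_lt_of_le hx (hY ω)
    refine tsub_eq_zero_of_le ?_
    rw [h1, ← measure_univ (μ := (P : Measure Ω))]
    exact le_capacity hP univ
  rw [choquet, h0, EReal.coe_ennreal_zero, sub_zero, ← EReal.coe_ennreal_top] at h
  exact EReal.coe_ennreal_lt_coe_ennreal_iff.1 h

theorem lintegral_le_lintegral_capacity {P : ProbabilityMeasure Ω} (hP : P ∈ 𝒬) {Y : Ω → ℝ}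
    (hYm : Measurable Y) (hY : ∀ ω, 0 ≤ Y ω) :
    ∫⁻ ω, ENNReal.ofReal (Y ω) ∂(P : Measure Ω)
      ≤ ∫⁻ x in Ioi (0 : ℝ), capacity 𝒬 {ω | x < Y ω} := by
  rw [lintegral_eq_lintegral_meas_lt _ (ae_of_all _ hY) hYm.aemeasurable]
  exact lintegral_mono fun x => le_capacity hP _

theorem card_Icc_one {d : ℕ} (n : Fin d → ℕ+) : ((Finset.Icc 1 n).card : ℝ) = size n := by
  rw [Pi.card_Icc, Nat.cast_prod]
  exact Finset.prod_congr rfl fun i _ => by simp [PNat.card_Icc]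

theorem posLog_size {d : ℕ} (n : Fin d → ℕ+) : Real.posLog (size n) = Real.log (size n) :=
  max_eq_right (Real.log_nonneg (one_le_size n))

/-! ### Tails of the partial sums and the final summation. -/

/-- Upper tails of the sums of truncated variables. -/
theorem exists_capacity_sum_min_le (h𝒬 : Represents 𝒬 𝓔) {α l ε M : ℝ} (hα : 1 < α)
    (hl0 : 0 < l) (hl1 : l < 1) (hε : 0 < ε) (hM : 0 ≤ M) {d : ℕ} {X : Ω → ℝ} (hX : X ∈ 𝓔.H)
    {Xf : (Fin d → ℕ+) → Ω → ℝ} (hXf : ∀ k, Xf k ∈ 𝓔.H) (hident : ∀ k, IdentDist 𝓔 (Xf k) X)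
    (hindep : IndepFamily 𝓔 Xf) (hmom : ∀ P ∈ 𝒬,
      ∫⁻ ω, ENNReal.ofReal (Real.exp (Real.posLog (X ω) ^ α)) ∂(P : Measure Ω) ≤ ENNReal.ofReal M)
    {σ : ℝ} (hσ : |σ| = 1) (hmean : ∀ P ∈ 𝒬, ∫ ω, σ * X ω ∂(P : Measure Ω) ≤ 0) :
    ∃ C : ℝ, 0 ≤ C ∧ ∀ n : Fin d → ℕ+,
      capacity 𝒬 {ω | size n * ε < ∑ k ∈ Finset.Icc 1 n, min (σ * Xf k ω) (size n)}
        ≤ ENNReal.ofReal (C * Real.exp (-(ε * l * Real.log (size n) ^ α))) := by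
  obtain ⟨c, hc, hev⟩ := eventually_lintegral_exp_tilt_le (Ω := Ω) hα hl0 hl1 hM
  obtain ⟨N₀, hN₀⟩ := eventually_atTop.1 hev
  have hXm := 𝓔.measurable_of_mem X hX
  have habs : ∀ x, Real.posLog (σ * x) = Real.posLog x := fun x => by
    rw [← Real.posLog_abs, abs_mul, hσ, one_mul, Real.posLog_abs]
  -- The first summand serves `size n ≥ N₀`; the second makes the bound at least 1 for smaller
  -- sizes.
  refine ⟨Real.exp c + Real.exp (ε * l * Real.log N₀ ^ α), by positivity, fun n => ?_⟩
  have hn1 := one_le_size n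
  have hn0 : 0 < size n := by linarith
  have hlog := Real.log_nonneg hn1
  rcases le_total N₀ (size n) with h | h
  · have hb : ∀ P ∈ 𝒬, ∫⁻ ω, ENNReal.ofReal (Real.exp (tilt α l (size n)
        * min (σ * X ω) (size n))) ∂(P : Measure Ω)
          ≤ ENNReal.ofReal (Real.exp (c / size n)) := fun P hP =>
      hN₀ _ h (P : Measure Ω) (fun ω => σ * X ω) (hXm.const_mul σ)
        (by simpa only [habs] using hmom P hP) (hmean P hP)
    have htilt : 0 ≤ tilt α l (size n) := by unfold tilt; positivity
    refine (capacity_sum_min_le h𝒬 hX hXf hident hindep htilt hσ.le hb _).trans ?_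
    refine ENNReal.ofReal_le_ofReal ?_
    have e1 : ((Finset.Icc 1 n).card : ℝ) * (c / size n) - tilt α l (size n) * (size n * ε)
        = c + -(ε * l * Real.log (size n) ^ α) := by
      rw [card_Icc_one, tilt]
      field_simp
      ring
    rw [e1, Real.exp_add]
    gcongr
    linarith [Real.exp_pos (ε * l * Real.log N₀ ^ α)]
  · refine (capacity_le_one _).trans (ENNReal.one_le_ofReal.2 ?_)
    have e2 : Real.exp (ε * l * Real.log (size n) ^ α)
        ≤ Real.exp c + Real.exp (ε * l * Real.log N₀ ^ α) := by
      have : Real.exp (ε * l * Real.log (size n) ^ α) ≤ Real.exp (ε * l * Real.log N₀ ^ α) := by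
        gcongr
      linarith [Real.exp_pos c]
    rw [Real.exp_neg, ← div_eq_mul_inv, le_div_iff₀ (by positivity), one_mul]
    exact e2

/-- Either some summand exceeds the truncation level or one of the truncated sums is large. -/
theorem capacity_partialSum_le {d : ℕ} (Xf : (Fin d → ℕ+) → Ω → ℝ) (n : Fin d → ℕ+) (a : ℝ) :
    capacity 𝒬 {ω | a < |partialSum Xf n ω|}
      ≤ ∑ k ∈ Finset.Icc 1 n, capacity 𝒬 {ω | size n < |Xf k ω|}
        + (capacity 𝒬 {ω | a < ∑ k ∈ Finset.Icc 1 n, min (1 * Xf k ω) (size n)}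
          + capacity 𝒬 {ω | a < ∑ k ∈ Finset.Icc 1 n, min (-1 * Xf k ω) (size n)}) := by
  refine le_trans (capacity_mono ?_) ((capacity_union_le _ _).trans
    (add_le_add (capacity_biUnion_finset_le (Finset.Icc 1 n) fun k => {ω | size n < |Xf k ω|})
      (capacity_union_le _ _)))
  intro ω hω
  by_cases hbig : ∃ k ∈ Finset.Icc 1 n, size n < |Xf k ω|
  · left
    simpa only [mem_iUnion, mem_ofPred_eq, exists_prop] using hbig
  push Not at hbig
  right
  have e1 : ∑ k ∈ Finset.Icc 1 n, min (1 * Xf k ω) (size n) = partialSum Xf n ω :=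
    Finset.sum_congr rfl fun k hk => by
      rw [one_mul, min_eq_left ((le_abs_self _).trans (hbig k hk))]
  have e2 : ∑ k ∈ Finset.Icc 1 n, min (-1 * Xf k ω) (size n) = -partialSum Xf n ω := by
    rw [partialSum, ← Finset.sum_neg_distrib]
    refine Finset.sum_congr rfl fun k hk => ?_
    rw [neg_one_mul, min_eq_left ((neg_le_abs _).trans (hbig k hk))]
  rcases lt_abs.1 (show a < |partialSum Xf n ω| from hω) with h | h
  · left; rwa [mem_ofPred_eq, e1]
  · right; rwa [mem_ofPred_eq, e2]

/-- What remains is `L ^ (α - 1) exp (-η L ^ α)`, controlled by `L ^ (α - 1) ≤ 1 + L ^ α`. It is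
applied with `1 + η = ε l`. -/
theorem exp_rpow_mul_rpow_mul_exp_le {α η L : ℝ} (hα : 1 < α) (hη : 0 < η) (hL : 0 ≤ L) :
    Real.exp (L ^ α) * L ^ (α - 1) * Real.exp (-((1 + η) * L ^ α)) ≤ 1 + η⁻¹ := by
  have h1 : L ^ (α - 1) ≤ 1 + L ^ α := by
    have h0 : 0 ≤ L ^ α := by positivity
    rcases le_total L 1 with h | h
    · have := Real.rpow_le_one hL h (by linarith : 0 ≤ α - 1)
      linarith
    · have := Real.rpow_le_rpow_of_exponent_le h (by linarith : α - 1 ≤ α)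
      linarith
  set t := L ^ α
  have ht : 0 ≤ t := by positivity
  have e1 : Real.exp t * L ^ (α - 1) * Real.exp (-((1 + η) * t))
      = L ^ (α - 1) / Real.exp (η * t) := by
    rw [div_eq_mul_inv, ← Real.exp_neg, mul_right_comm, ← Real.exp_add, mul_comm]
    ring_nf
  rw [e1, div_le_iff₀ (Real.exp_pos _)]
  have h2 := Real.add_one_le_exp (η * t)
  have h3 : (1 + η⁻¹) * (η * t + 1) ≤ (1 + η⁻¹) * Real.exp (η * t) := by gcongr
  have h4 : (1 + η⁻¹) * (η * t + 1) = η * t + 1 + t + η⁻¹ := by field_simp; ring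
  have h5 : 0 < η⁻¹ := by positivity
  have h6 : 0 ≤ η * t := by positivity
  linarith

theorem exp_posLog_rpow_le {α x : ℝ} (hα : 0 ≤ α) (d : ℕ) :
    Real.exp (Real.posLog x ^ α)
      ≤ Real.exp 1 + Real.exp (Real.posLog x ^ α) * Real.posLog x ^ d := by
  have h0 : 0 ≤ Real.posLog x := Real.posLog_nonneg
  rcases le_total (Real.posLog x) 1 with h | h
  · have h1 : Real.exp (Real.posLog x ^ α) ≤ Real.exp 1 := by
      gcongr
      exact Real.rpow_le_one h0 h hα
    have : 0 ≤ Real.exp (Real.posLog x ^ α) * Real.posLog x ^ d := by positivity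
    linarith
  · have := le_mul_of_one_le_right (Real.exp_pos (Real.posLog x ^ α)).le (one_le_pow₀ h (n := d))
    linarith [Real.exp_pos 1]

theorem exp_log_rpow_mul_pow_lt {α x y : ℝ} (hα : 0 < α) {d : ℕ} (hd : d ≠ 0) (hx : 1 ≤ x)
    (hxy : x < y) :
    Real.exp (Real.log x ^ α) * Real.log x ^ d
      < Real.exp (Real.posLog y ^ α) * Real.posLog y ^ d := by
  have hl := Real.log_nonneg hx
  have h1 : Real.log x < Real.posLog y :=
    (Real.log_lt_log (by linarith) hxy).trans_le (le_max_right _ _)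
  exact mul_lt_mul'' (Real.exp_lt_exp.2 (Real.rpow_lt_rpow hl h1 hα))
    (pow_lt_pow_left₀ h1 hl hd) (by positivity) (by positivity)

/-- By the layer-cake formula the Choquet integral dominates every `E_P`; uniformity in `P` makes
the constant `c` of the exponential bound uniform. -/
theorem exists_lintegral_exp_le (h𝒬 : 𝒬.Nonempty) {α : ℝ} (hα : 0 ≤ α) {d : ℕ} {X : Ω → ℝ}
    (hX : Measurable X)
    (hmom : choquet (capacity 𝒬)
      (fun ω => Real.exp ((Real.posLog |X ω|) ^ α) * (Real.posLog |X ω|) ^ d) < ⊤) :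
    ∃ M : ℝ, 0 ≤ M ∧ ∀ P ∈ 𝒬,
      ∫⁻ ω, ENNReal.ofReal (Real.exp (Real.posLog (X ω) ^ α)) ∂(P : Measure Ω)
        ≤ ENNReal.ofReal M := by
  simp only [Real.posLog_abs] at hmom
  set Y : Ω → ℝ := fun ω => Real.exp (Real.posLog (X ω) ^ α) * Real.posLog (X ω) ^ d with hYdef
  have hnn : ∀ ω, 0 ≤ Real.posLog (X ω) := fun ω => Real.posLog_nonneg
  have hY : ∀ ω, 0 ≤ Y ω := fun ω => mul_nonneg (Real.exp_pos _).le (pow_nonneg (hnn ω) _)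
  have hYm : Measurable Y := by
    simp only [hYdef, Real.posLog]
    fun_prop
  have hfin := lintegral_capacity_lt_top h𝒬 hY hmom
  set I := ∫⁻ x in Ioi (0 : ℝ), capacity 𝒬 {ω | x < Y ω}
  refine ⟨Real.exp 1 + I.toReal, by positivity, fun P hP => ?_⟩
  calc _ ≤ ∫⁻ ω, (ENNReal.ofReal (Real.exp 1) + ENNReal.ofReal (Y ω)) ∂(P : Measure Ω) :=
        lintegral_mono fun ω => by
          rw [← ENNReal.ofReal_add (Real.exp_pos 1).le (hY ω)]
          exact ENNReal.ofReal_le_ofReal (exp_posLog_rpow_le hα d)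
    _ = ENNReal.ofReal (Real.exp 1) + ∫⁻ ω, ENNReal.ofReal (Y ω) ∂(P : Measure Ω) := by
        rw [lintegral_add_left measurable_const]
        simp
    _ ≤ ENNReal.ofReal (Real.exp 1) + I := by
        gcongr
        exact lintegral_le_lintegral_capacity hP hYm hY
    _ = _ := by
        rw [ENNReal.ofReal_add (Real.exp_pos 1).le ENNReal.toReal_nonneg,
          ENNReal.ofReal_toReal hfin.ne]

theorem Represents.integral_le_zero (h𝒬 : Represents 𝒬 𝓔) {Y : Ω → ℝ} (hY : Y ∈ 𝓔.H)
    (h : 𝓔.E Y = 0) {P : ProbabilityMeasure Ω} (hP : P ∈ 𝒬)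
    (hint : Integrable Y (P : Measure Ω)) : ∫ ω, Y ω ∂(P : Measure Ω) ≤ 0 := by
  have := h𝒬.linExp_le hY hP
  rw [h, linExp_of_integrable P hint] at this
  exact_mod_cast this

theorem SubLinearExpectation.neg_mem (𝓔 : SubLinearExpectation Ω) {X : Ω → ℝ} (hX : X ∈ 𝓔.H) :
    (fun ω => -X ω) ∈ 𝓔.H := by
  refine 𝓔.comp_mem 1 (fun _ => X) (fun _ => hX) (fun x => -x 0) ⟨1, one_pos, 0, fun x y => ?_⟩
  have h := norm_le_pi_norm (x - y) 0
  rw [Pi.sub_apply, Real.norm_eq_abs, abs_sub_comm] at h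
  rw [neg_sub_neg]
  norm_num
  linarith [norm_nonneg (x - y)]

end SubLin

theorem theorem5p1 {Ω : Type*} [MeasurableSpace Ω]
    (𝓔 : SubLin.SubLinearExpectation Ω)
    (𝒬 : Set (ProbabilityMeasure Ω)) (h𝒬 : SubLin.Represents 𝒬 𝓔)
    (d : ℕ) (hd : 2 ≤ d) (α : ℝ) (hα : 1 < α)
    (X : Ω → ℝ) (hX : X ∈ 𝓔.H)
    (Xf : (Fin d → ℕ+) → Ω → ℝ) (hXf : ∀ k, Xf k ∈ 𝓔.H)
    (hident : ∀ k, SubLin.IdentDist 𝓔 (Xf k) X)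
    (hindep : SubLin.IndepFamily 𝓔 Xf)
    (hmean : 𝓔.E X = 0) (hmean' : 𝓔.E (fun ω => -X ω) = 0)
    (hmom : SubLin.choquet (SubLin.capacity 𝒬)
      (fun ω => Real.exp ((Real.posLog |X ω|) ^ α) * (Real.posLog |X ω|) ^ (d - 1)) < ⊤) :
    ∀ ε : ℝ, 1 < ε →
      ∑' n : Fin d → ℕ+,
        ENNReal.ofReal (Real.exp ((Real.posLog (SubLin.size n)) ^ α)
            * (Real.posLog (SubLin.size n)) ^ (α - 1) / (SubLin.size n) ^ 2)
          * SubLin.capacity 𝒬 {ω | SubLin.size n * ε < |SubLin.partialSum Xf n ω|} < ⊤ := by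
  open SubLin in
  intro ε hε
  obtain ⟨d, rfl⟩ : ∃ d', d = d' + 1 := ⟨d - 1, by omega⟩
  rw [Nat.add_sub_cancel] at hmom
  have hne := h𝒬.nonempty hX hmean
  have hXm := 𝓔.measurable_of_mem X hX
  obtain ⟨M, hM, hexp⟩ := exists_lintegral_exp_le hne (by linarith) hXm hmom
  have hint : ∀ P ∈ 𝒬, Integrable X (P : Measure Ω) := fun P hP =>
    (integrable_of_exp_posLog_rpow hα hXm
      ⟨((measurable_exp_posLog_rpow α).comp hXm).aestronglyMeasurable, by
        rw [hasFiniteIntegral_iff_ofReal (ae_of_all _ fun _ => (Real.exp_pos _).le)]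
        exact (hexp P hP).trans_lt ENNReal.ofReal_lt_top⟩).2
  -- `l < 1` is needed for the moment generating function, `ε l > 1` for summability; this is where
  -- `ε > 1` enters.
  obtain ⟨l, hεl, hl1⟩ := exists_between (inv_lt_one_of_one_lt₀ hε)
  have hε0 : 0 < ε := by linarith
  have hl0 : 0 < l := (inv_pos.2 hε0).trans hεl
  have hη : 0 < ε * l - 1 := by
    have := (inv_lt_iff_one_lt_mul₀' hε0).1 hεl
    linarith
  obtain ⟨C₁, hC₁, hb₁⟩ := exists_capacity_sum_min_le h𝒬 hα hl0 hl1 hε0 hM hX hXf hident hindep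
    hexp (σ := 1) (by simp) fun P hP => by
      simpa using h𝒬.integral_le_zero hX hmean hP (hint P hP)
  obtain ⟨C₂, hC₂, hb₂⟩ := exists_capacity_sum_min_le h𝒬 hα hl0 hl1 hε0 hM hX hXf hident hindep
    hexp (σ := -1) (by simp) fun P hP => by
      simpa only [neg_one_mul] using
        h𝒬.integral_le_zero (𝓔.neg_mem hX) hmean' hP (hint P hP).neg
  let W : ℝ → ℝ≥0∞ := fun x => capacity 𝒬 {ω | x < |X ω|}
  have hW : Antitone W := fun x y hxy => capacity_mono fun ω hω => lt_of_le_of_lt hxy hω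
  have htail := tsum_tail_lt_top hα d hW (fun _ => capacity_le_one _)
    (U := fun y => capacity 𝒬
      {ω | y < Real.exp ((Real.posLog |X ω|) ^ α) * (Real.posLog |X ω|) ^ d})
    (fun x hx => capacity_mono fun ω hω =>
      exp_log_rpow_mul_pow_lt (by linarith) (by omega) hx hω)
    (lintegral_capacity_lt_top hne (fun ω => mul_nonneg (Real.exp_pos _).le
      (pow_nonneg Real.posLog_nonneg _)) hmom)
  set K : ℝ := (1 + (ε * l - 1)⁻¹) * (C₁ + C₂) with hK
  have hK0 : 0 ≤ K := by positivity
  -- In the first term of the majorant, the `size n` summands that may be large turn `1 / size n ^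
  -- 2` into `1 / size n`.
  refine lt_of_le_of_lt (ENNReal.tsum_le_tsum
    (g := fun n => ENNReal.ofReal (Real.exp (Real.log (size n) ^ α)
      * Real.log (size n) ^ (α - 1) / size n) * W (size n)
      + ENNReal.ofReal K * ENNReal.ofReal ((size n ^ 2)⁻¹)) fun n => ?_) ?_
  · have hn1 := one_le_size n
    have hn0 : 0 < size n := by linarith
    have hlog := Real.log_nonneg hn1
    rw [posLog_size]
    refine (mul_le_mul_right (capacity_partialSum_le Xf n _) _).trans ?_
    rw [mul_add]
    gcongr ?_ + ?_
    · have h1 : ∑ k ∈ Finset.Icc 1 n, capacity 𝒬 {ω | size n < |Xf k ω|}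
          ≤ ENNReal.ofReal (size n) * W (size n) := by
        refine (Finset.sum_le_card_nsmul _ _ (W (size n)) fun k _ =>
          capacity_tail_le_of_identDist h𝒬 hX (hXf k) (hident k) (size n)).trans_eq ?_
        rw [nsmul_eq_mul, ← card_Icc_one, ENNReal.ofReal_natCast]
      refine (mul_le_mul_right h1 _).trans_eq ?_
      rw [← mul_assoc, ← ENNReal.ofReal_mul (by positivity)]
      congr 2
      field_simp
    · refine (mul_le_mul_right (add_le_add (hb₁ n) (hb₂ n)) _).trans ?_
      rw [← ENNReal.ofReal_add (by positivity) (by positivity), ← ENNReal.ofReal_mul (by positivity),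
        ← ENNReal.ofReal_mul hK0]
      refine ENNReal.ofReal_le_ofReal ?_
      have h2 := exp_rpow_mul_rpow_mul_exp_le hα hη hlog
      rw [add_sub_cancel] at h2
      have h3 := mul_le_mul_of_nonneg_right h2
        (by positivity : 0 ≤ (C₁ + C₂) * (size n ^ 2)⁻¹)
      refine le_trans (le_of_eq ?_) (h3.trans_eq ?_)
      · rw [div_eq_mul_inv]; ring
      · rw [hK]; ring
  · rw [ENNReal.tsum_add, ENNReal.tsum_mul_left]
    exact ENNReal.add_lt_top.2 ⟨htail,
      ENNReal.mul_lt_top ENNReal.ofReal_lt_top (tsum_inv_size_sq_lt_top (d + 1))⟩
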